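/- Linear delegation. Fix $m\ge 2$ alternatives and let $d=m-1$. The allocation space is the simplex $A=\{a\in\mathbb{R}^d_+ : \sum_{i=1}^d a_i\le 1\}$ of lotteries over the $m$ alternatives, where $a_i$ is the probability of alternative $i\le d$ and $1-\sum_i a_i$ is the probability of alternative $m$. The type space is the unit sphere $\Theta=\mathbb{S}^{d-1}\subset\mathbb{R}^d$ with the spherical measure; type $\theta$ has utility $a\cdot\theta$ from $a\in A$. A mechanism is a measurable map $x:\Theta\to A$ that is incentive-compatible: $x(\theta)\cdot\theta\ge x(\theta')\cdot\theta$ for all $\theta,\theta'\in\Theta$. Two mechanisms $x,x'$ are payoff-equivalent if $x(\theta)\cdot\theta=x'(\theta)\cdot\theta$ for all $\theta\in\Theta$. Mechanisms that are equal almost everywhere are identified; $\mathcal{X}$ denotes the resulting set of equivalence classes, regarded as a subset of $L^1(\Theta;\mathbb{R}^d)$ with norm $\|x\|=\int_\Theta\|x(\theta)\|\,d\theta$, and $\operatorname{ext}\mathcal{X}$ its set of extreme points. The menu of a mechanism $x$ is $$\operatorname{menu}(x)=\operatorname{cl}\bigcap\{x'(\Theta) : x' \text{ a mechanism payoff-equivalent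 to } x\},$$ and its menu size is $|\operatorname{menu}(x)|$. The mechanism $x$ dictates an alternative if $\operatorname{menu}(x)=\{a\}$ for some extreme point $a$ of $A$; it grants a strike if for every alternative $k=1,\dots,m$ some lottery in $\operatorname{menu}(x)$ chooses $k$ with probability $0$. Theorem. (1) If $m=3$, a mechanism $x$ is an extreme point of $\mathcal{X}$ (that is, its class is in $\operatorname{ext}\mathcal{X}$) if and only if either $x$ dictates an alternative, or $x$ grants a strike and has menu size at most three. (2) If $m\ge 4$, the extreme points of $\mathcal{X}$ that grant a strike are dense, in the $L^1$ norm, in the set of all elements of $\mathcal{X}$ that grant a strike; in particular $\operatorname{ext}\mathcal{X}$ is dense in the set of mechanisms that grant a strike. -/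

import Mathlib

open MeasureTheory

noncomputable section

namespace LinearDelegation

/-- The allocation space of linear delegation with `m = d + 1` alternatives: the unit simplex
`{a ∈ ℝ^d_+ : ∑ a_i ≤ 1}`; `a` lists the probabilities of the first `d` alternatives. -/
def lotteries (d : ℕ) : Set (EuclideanSpace ℝ (Fin d)) :=
  {a | (∀ i, 0 ≤ a i) ∧ ∑ i, a i ≤ 1}

/-- The probability of alternative `k` (out of `d + 1` alternatives) under the lottery `a`;
the last alternative receives the remaining probability. -/
def prob {d : ℕ} (a : EuclideanSpace ℝ (Fin d)) (k : Fin (d + 1)) : ℝ :=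
  Fin.lastCases (motive := fun _ => ℝ) (1 - ∑ i, a i) (fun i => a i) k

/-- The unrestricted type space `𝕊^{d-1}`: all directions of von Neumann-Morgenstern utilities. -/
abbrev TypeSpace (d : ℕ) : Type := Metric.sphere (0 : EuclideanSpace ℝ (Fin d)) 1

/-- The spherical measure on the type space. -/
abbrev sphericalMeasure (d : ℕ) : Measure (TypeSpace d) :=
  (volume : Measure (EuclideanSpace ℝ (Fin d))).toSphere

/-- A (direct, measurable) incentive-compatible mechanism. -/
structure Mechanism (d : ℕ) where
  alloc : TypeSpace d → EuclideanSpace ℝ (Fin d)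
  measurable_alloc : Measurable alloc
  alloc_mem : ∀ θ, alloc θ ∈ lotteries d
  incentive_compatible : ∀ θ θ' : TypeSpace d,
    inner ℝ (alloc θ') (θ : EuclideanSpace ℝ (Fin d)) ≤
      inner ℝ (alloc θ) (θ : EuclideanSpace ℝ (Fin d))

theorem norm_le_one_of_mem_lotteries {d : ℕ} {a : EuclideanSpace ℝ (Fin d)}
    (ha : a ∈ lotteries d) : ‖a‖ ≤ 1 := by
  obtain ⟨h0, h1⟩ := ha
  rw [EuclideanSpace.norm_eq, Real.sqrt_le_one]
  refine le_trans (Finset.sum_le_sum fun i _ => ?_) h1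
  have hi : a i ≤ 1 :=
    le_trans (Finset.single_le_sum (fun j _ => h0 j) (Finset.mem_univ i)) h1
  rw [Real.norm_eq_abs, sq_abs]
  nlinarith [h0 i]

namespace Mechanism

variable {d : ℕ}

theorem memLp_alloc (x : Mechanism d) : MemLp x.alloc 1 (sphericalMeasure d) :=
  MemLp.of_bound x.measurable_alloc.aestronglyMeasurable 1
    (Filter.Eventually.of_forall fun θ => norm_le_one_of_mem_lotteries (x.alloc_mem θ))

/-- The almost-everywhere equivalence class of a mechanism, as an element of `L¹`. -/
def toL1 (x : Mechanism d) : Lp (EuclideanSpace ℝ (Fin d)) 1 (sphericalMeasure d) :=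
  x.memLp_alloc.toLp x.alloc

/-- The agent's indirect utility function. -/
def indirectUtility (x : Mechanism d) (θ : TypeSpace d) : ℝ :=
  inner ℝ (x.alloc θ) (θ : EuclideanSpace ℝ (Fin d))

/-- Two mechanisms are payoff-equivalent if they induce the same indirect utility function. -/
def PayoffEquivalent (x y : Mechanism d) : Prop := x.indirectUtility = y.indirectUtility

/-- The (essential) menu: the closure of the set of allocations that are made by every
incentive-compatible mechanism payoff-equivalent to `x`. -/
def menu (x : Mechanism d) : Set (EuclideanSpace ℝ (Fin d)) :=
  closure (⋂ y : {y : Mechanism d // PayoffEquivalent y x}, Set.range y.1.alloc)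

/-- The menu consists of a single extreme point of the simplex of lotteries. -/
def DictatesAlternative (x : Mechanism d) : Prop :=
  ∃ a ∈ (lotteries d).extremePoints ℝ, x.menu = {a}

/-- For every alternative the menu contains a lottery choosing it with probability zero. -/
def GrantsStrike (x : Mechanism d) : Prop :=
  ∀ k : Fin (d + 1), ∃ a ∈ x.menu, prob a k = 0

end Mechanism

/-- The set of equivalence classes of incentive-compatible mechanisms, inside `L¹`. -/
def mechanismClasses (d : ℕ) : Set (Lp (EuclideanSpace ℝ (Fin d)) 1 (sphericalMeasure d)) :=
  Set.range Mechanism.toL1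

/-- The set of (classes of) mechanisms that grant a strike. -/
def strikeClasses (d : ℕ) : Set (Lp (EuclideanSpace ℝ (Fin d)) 1 (sphericalMeasure d)) :=
  Mechanism.toL1 '' {x | x.GrantsStrike}

end LinearDelegation

end

/-! A mechanism is encoded by the support function of its range, `supp`, which extends the indirect
utility from the sphere to the whole space. By Rademacher's theorem almost every type has a unique
optimal point, so the `L¹` class and the support function determine each other (`toL1_eq_iff`), and
convex combinations of classes become convex combinations of support functions (`supp_combination`).
Extreme points are therefore convex bodies inside the simplex that cannot be split as Minkowski
combinations of different bodies inside the simplex. Granting a strike means that the body touches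
every facet (`grantsStrike_iff`).

If the body misses the facet of alternative `k`, it can be scaled about vertex `k` by factors
slightly above and below one without leaving the simplex. For an extreme point this forces the body
to be that vertex. If the body touches every facet, so does each body in a decomposition, since
support values add up. A translated rescaling of the body that still touches every facet has ratio
one and translation zero. It thus suffices that every summand is such a translated rescaling
(`toL1_mem_extremePoints_of_rigid`).

This rigidity holds for simplices, hence for menus of at most three points, because exposed points
of such a menu are affinely independent. In dimension at least three it holds for every
full-dimensional polytope with simplicial proper faces: on each face the summand has one ratio,
faces sharing an edge have the same ratio, and the boundary stays connected when the vertices are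
removed (`IsSummand.exists_global_homothety`). Finite families that touch all facets can be
perturbed into general position without losing contact, which makes the polytope simplicial.
Sampling the allocations of a strike mechanism at more and more types then gives density.

In the plane the vertices disconnect the boundary, and rigidity fails beyond three menu points. Four
types with different unique optima cut the circle into four arcs. Rescaling and translating each arc
separately has 12 parameters. Closing up costs 8 linear conditions and keeping the three facet
contacts costs 3, so a nontrivial perturbation survives (`exists_rescaling`). -/

open scoped Topology

namespace LinearDelegation

/-! ### The simplex in barycentric coordinates -/

section Simplex

variable {d : ℕ}

/-- The outward normal of the facet of the simplex on which alternative `k` has probability zero. -/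
noncomputable def facetNormal (k : Fin (d + 1)) : EuclideanSpace ℝ (Fin d) :=
  Fin.lastCases (motive := fun _ => EuclideanSpace ℝ (Fin d)) (WithLp.toLp 2 fun _ => 1)
    (fun i => -EuclideanSpace.single i 1) k

/-- The value of the support function of the simplex at `facetNormal k`. -/
noncomputable def facetOffset (k : Fin (d + 1)) : ℝ :=
  Fin.lastCases (motive := fun _ => ℝ) 1 (fun _ => 0) k

theorem prob_eq (a : EuclideanSpace ℝ (Fin d)) (k : Fin (d + 1)) :
    prob a k = facetOffset k - inner ℝ a (facetNormal k) := by
  refine Fin.lastCases ?_ (fun i => ?_) k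
  · simp [prob, facetOffset, facetNormal, PiLp.inner_apply]
  · simp [prob, facetOffset, facetNormal, inner_neg_right, EuclideanSpace.inner_single_right]

theorem mem_lotteries_iff {a : EuclideanSpace ℝ (Fin d)} :
    a ∈ lotteries d ↔ ∀ k, 0 ≤ prob a k := by
  constructor
  · rintro ⟨h0, h1⟩ k
    refine Fin.lastCases ?_ (fun i => ?_) k
    · simpa [prob] using h1
    · simpa [prob] using h0 i
  · intro h
    refine ⟨fun i => by simpa [prob] using h i.castSucc, by simpa [prob] using h (Fin.last d)⟩

theorem sum_prob (a : EuclideanSpace ℝ (Fin d)) : ∑ k, prob a k = 1 := by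
  rw [Fin.sum_univ_castSucc]
  simp [prob]

theorem eq_of_prob_eq {a b : EuclideanSpace ℝ (Fin d)} (h : ∀ k, prob a k = prob b k) : a = b := by
  ext i
  simpa [prob] using h i.castSucc

theorem prob_combination (a b : EuclideanSpace ℝ (Fin d)) {s t : ℝ} (hst : s + t = 1)
    (k : Fin (d + 1)) : prob (s • a + t • b) k = s * prob a k + t * prob b k := by
  simp only [prob_eq, inner_add_left, inner_smul_left, RCLike.conj_to_real]
  linear_combination (-facetOffset k) * hst

theorem facetNormal_ne_zero [NeZero d] (k : Fin (d + 1)) : facetNormal k ≠ 0 := by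
  refine Fin.lastCases ?_ (fun i => ?_) k
  · intro h
    have := congrArg (fun v : EuclideanSpace ℝ (Fin d) => v 0) h
    simp [facetNormal] at this
  · simp [facetNormal]

theorem continuous_prob (k : Fin (d + 1)) :
    Continuous fun a : EuclideanSpace ℝ (Fin d) => prob a k := by
  simp only [prob_eq]
  fun_prop

theorem isClosed_lotteries : IsClosed (lotteries d) := by
  have : lotteries d = ⋂ k, {a | 0 ≤ prob a k} := by
    ext a
    simp [mem_lotteries_iff]
  rw [this]
  exact isClosed_iInter fun k => isClosed_le continuous_const (continuous_prob k)

theorem isCompact_lotteries : IsCompact (lotteries d) := by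
  refine Metric.isCompact_of_isClosed_isBounded isClosed_lotteries ?_
  refine (Metric.isBounded_closedBall (x := 0) (r := 1)).subset fun a ha => ?_
  simpa using norm_le_one_of_mem_lotteries ha

/-- The lottery that picks alternative `k` for sure. -/
noncomputable def vertex (k : Fin (d + 1)) : EuclideanSpace ℝ (Fin d) :=
  Fin.lastCases (motive := fun _ => EuclideanSpace ℝ (Fin d)) 0
    (fun i => EuclideanSpace.single i 1) k

theorem prob_vertex (j k : Fin (d + 1)) : prob (vertex j) k = if k = j then 1 else 0 := by
  refine Fin.lastCases ?_ (fun i => ?_) j <;> refine Fin.lastCases ?_ (fun l => ?_) k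
  · simp [prob, vertex]
  · simp [prob, vertex, (Fin.castSucc_lt_last _).ne]
  · simp [prob, vertex, (Fin.castSucc_lt_last _).ne']
  · simp [prob, vertex]

theorem vertex_mem_lotteries (k : Fin (d + 1)) : vertex k ∈ lotteries d := by
  rw [mem_lotteries_iff]
  intro j
  rw [prob_vertex]
  split_ifs <;> simp

theorem vertex_mem_extremePoints (k : Fin (d + 1)) :
    vertex k ∈ (lotteries d).extremePoints ℝ := by
  refine ⟨vertex_mem_lotteries k, ?_⟩
  rintro a ha b hb ⟨s, t, hs, ht, hst, h⟩
  rw [mem_lotteries_iff] at ha hb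
  refine eq_of_prob_eq fun j => ?_
  have hne : ∀ j, j ≠ k → prob a j = 0 := fun j hj => by
    have := prob_combination a b hst j
    rw [h, prob_vertex, if_neg hj] at this
    have h1 := mul_nonneg hs.le (ha j)
    have h2 := mul_nonneg ht.le (hb j)
    have h3 : s * prob a j = 0 := by linarith
    exact (mul_eq_zero.1 h3).resolve_left hs.ne'
  rw [prob_vertex]
  split_ifs with hj
  · have := sum_prob a
    rw [Finset.sum_eq_single k (fun j _ hj => hne j hj) (by simp)] at this
    rw [hj, this]
  · exact hne j hj

instance [NeZero d] : Nonempty (TypeSpace d) :=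
  ⟨⟨EuclideanSpace.single 0 1, by simp⟩⟩

end Simplex

/-! ### Mechanisms as support functions -/

namespace Mechanism

variable {d : ℕ}

/-- The support function of the range of a mechanism; it extends the indirect utility function
from the unit sphere to the whole space. -/
noncomputable def supp (x : Mechanism d) (z : EuclideanSpace ℝ (Fin d)) : ℝ :=
  ⨆ θ, inner ℝ (x.alloc θ) z

theorem norm_alloc_le (x : Mechanism d) (θ : TypeSpace d) : ‖x.alloc θ‖ ≤ 1 :=
  norm_le_one_of_mem_lotteries (x.alloc_mem θ)

theorem bddAbove_inner (x : Mechanism d) (z : EuclideanSpace ℝ (Fin d)) :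
    BddAbove (Set.range fun θ => inner ℝ (x.alloc θ) z) := by
  refine ⟨‖z‖, ?_⟩
  rintro _ ⟨θ, rfl⟩
  refine (real_inner_le_norm _ _).trans ?_
  nlinarith [x.norm_alloc_le θ, norm_nonneg z]

theorem inner_le_supp (x : Mechanism d) (θ : TypeSpace d) (z : EuclideanSpace ℝ (Fin d)) :
    inner ℝ (x.alloc θ) z ≤ x.supp z :=
  le_ciSup (x.bddAbove_inner z) θ

theorem supp_coe (x : Mechanism d) (θ : TypeSpace d) :
    x.supp θ = inner ℝ (x.alloc θ) (θ : EuclideanSpace ℝ (Fin d)) :=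
  haveI : Nonempty (TypeSpace d) := ⟨θ⟩
  le_antisymm (ciSup_le fun φ => x.incentive_compatible θ φ) (x.inner_le_supp θ _)

theorem supp_smul (x : Mechanism d) {c : ℝ} (hc : 0 ≤ c) (z : EuclideanSpace ℝ (Fin d)) :
    x.supp (c • z) = c * x.supp z := by
  simp only [supp, inner_smul_right]
  exact (Real.mul_iSup_of_nonneg hc _).symm

theorem supp_zero (x : Mechanism d) : x.supp 0 = 0 := by
  simpa using x.supp_smul le_rfl 0

/-- The unit vector in the direction of a nonzero vector, as a type. -/
noncomputable def dir {z : EuclideanSpace ℝ (Fin d)} (hz : z ≠ 0) : TypeSpace d :=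
  ⟨‖z‖⁻¹ • z, by simp [norm_smul, hz]⟩

theorem norm_smul_dir {z : EuclideanSpace ℝ (Fin d)} (hz : z ≠ 0) :
    ‖z‖ • (dir hz : EuclideanSpace ℝ (Fin d)) = z := by
  simp [dir, smul_smul, hz]

theorem inner_dir (x : Mechanism d) {z : EuclideanSpace ℝ (Fin d)} (hz : z ≠ 0) :
    inner ℝ (x.alloc (dir hz)) z = x.supp z := by
  have h1 := x.supp_smul (norm_nonneg z) (dir hz)
  have h2 := inner_smul_right (𝕜 := ℝ) (x.alloc (dir hz)) (dir hz : EuclideanSpace ℝ (Fin d)) ‖z‖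
  rw [norm_smul_dir, supp_coe] at h1
  rw [norm_smul_dir] at h2
  exact h2.trans h1.symm

theorem supp_lipschitz [NeZero d] (x : Mechanism d) : LipschitzWith 1 x.supp := by
  refine LipschitzWith.of_le_add fun z w => ciSup_le fun θ => ?_
  have h1 := x.inner_le_supp θ w
  have h2 : inner ℝ (x.alloc θ) (z - w) ≤ dist z w := by
    rw [dist_eq_norm]
    refine (real_inner_le_norm _ _).trans ?_
    nlinarith [x.norm_alloc_le θ, norm_nonneg (z - w)]
  rw [inner_sub_right] at h2
  linarith

theorem supp_eq_iff_indirectUtility_eq (x y : Mechanism d) :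
    x.supp = y.supp ↔ x.indirectUtility = y.indirectUtility := by
  constructor
  · intro h
    ext θ
    rw [indirectUtility, indirectUtility, ← supp_coe, ← supp_coe, h]
  · intro h
    ext z
    by_cases hz : z = 0
    · rw [hz, supp_zero, supp_zero]
    · rw [← norm_smul_dir hz, supp_smul _ (norm_nonneg _), supp_smul _ (norm_nonneg _),
        supp_coe, supp_coe]
      exact congrArg _ (congrFun h (dir hz))

theorem payoffEquivalent_iff {x y : Mechanism d} : PayoffEquivalent x y ↔ x.supp = y.supp :=
  (supp_eq_iff_indirectUtility_eq x y).symm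

/-- The allocation of type `θ` is the only point of the convex body with support function `x.supp`
that is optimal for `θ`. -/
def UniqueAt (x : Mechanism d) (θ : TypeSpace d) : Prop :=
  ∀ p, (∀ z, inner ℝ p z ≤ x.supp z) →
    inner ℝ p (θ : EuclideanSpace ℝ (Fin d)) = x.supp θ → p = x.alloc θ

/-- If `p` supports the body at `θ`, then `supp` minus the linear form of `p` is minimal at `θ`, so
the derivative of `supp` there is the form of `p`. This determines `p`. -/
theorem uniqueAt_of_differentiableAt (x : Mechanism d) (θ : TypeSpace d)
    (h : DifferentiableAt ℝ x.supp θ) : x.UniqueAt θ := by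
  have key : ∀ p : EuclideanSpace ℝ (Fin d), (∀ z, inner ℝ p z ≤ x.supp z) →
      inner ℝ p (θ : EuclideanSpace ℝ (Fin d)) = x.supp θ →
      fderiv ℝ x.supp θ = innerSL ℝ p := by
    intro p hp hpθ
    have hmin : IsLocalMin (fun z => x.supp z - innerSL ℝ p z) θ := by
      refine Filter.Eventually.of_forall fun z => ?_
      have := hp z
      simp only [innerSL_apply_apply, hpθ]
      linarith
    have h0 := hmin.fderiv_eq_zero
    rw [fderiv_fun_sub h (innerSL ℝ p).differentiableAt, ContinuousLinearMap.fderiv] at h0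
    exact sub_eq_zero.1 h0
  intro p hp hpθ
  have h1 := (key p hp hpθ).symm.trans
    (key (x.alloc θ) (x.inner_le_supp θ) (x.supp_coe θ).symm)
  refine ext_inner_right ℝ fun v => ?_
  simpa using congrArg (fun L => L v) h1

/-- The spherical measure of a set is, up to a factor, the volume of the cone over it. By
homogeneity the cone over the bad types consists of points where `supp` is not differentiable, a
null set by Rademacher's theorem. -/
theorem ae_uniqueAt [NeZero d] (x : Mechanism d) :
    ∀ᵐ θ ∂sphericalMeasure d, x.UniqueAt θ := by
  have hms : MeasurableSet {z | DifferentiableAt ℝ x.supp z} :=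
    measurableSet_of_differentiableAt ℝ x.supp
  have hm : MeasurableSet {θ : TypeSpace d | ¬ DifferentiableAt ℝ x.supp θ} :=
    (measurable_subtype_coe hms).compl
  have h0 : ∀ᵐ θ : TypeSpace d ∂sphericalMeasure d, DifferentiableAt ℝ x.supp θ := by
    rw [ae_iff, Measure.toSphere_apply' _ hm]
    refine mul_eq_zero_of_right _
      (measure_mono_null ?_ (ae_iff.1 x.supp_lipschitz.ae_differentiableAt))
    rintro _ ⟨c, hc, _, ⟨θ, hθ, rfl⟩, rfl⟩ hdiff
    refine hθ ?_
    have hc0 : 0 < c := hc.1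
    have heq : x.supp = fun z => c⁻¹ * x.supp (c • z) := by
      ext z
      rw [supp_smul _ hc0.le, inv_mul_cancel_left₀ hc0.ne']
    rw [heq]
    have h1 : DifferentiableAt ℝ (fun z : EuclideanSpace ℝ (Fin d) => c • z) θ :=
      differentiableAt_id.const_smul c
    exact (DifferentiableAt.comp (θ : EuclideanSpace ℝ (Fin d)) hdiff h1).const_mul c⁻¹
  filter_upwards [h0] with θ hθ using x.uniqueAt_of_differentiableAt θ hθ

theorem alloc_eq_of_supp_eq {x y : Mechanism d} (h : x.supp = y.supp) {θ : TypeSpace d}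
    (hθ : x.UniqueAt θ) : y.alloc θ = x.alloc θ :=
  hθ _ (fun z => h ▸ y.inner_le_supp θ z) (by rw [h, supp_coe])

theorem dense_of_ae {P : TypeSpace d → Prop} (h : ∀ᵐ θ ∂sphericalMeasure d, P θ) :
    Dense {θ | P θ} :=
  Measure.dense_of_ae h

theorem continuous_supp_coe [NeZero d] (x : Mechanism d) :
    Continuous fun θ : TypeSpace d => x.supp θ :=
  x.supp_lipschitz.continuous.comp continuous_subtype_val

/-- Sets of full measure are dense in the sphere, so continuity gives equality there, and
homogeneity carries it to all vectors. -/
theorem supp_eq_of_ae [NeZero d] {F : EuclideanSpace ℝ (Fin d) → ℝ} (hF : Continuous F)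
    (hhom : ∀ c : ℝ, 0 ≤ c → ∀ z, F (c • z) = c * F z) {x : Mechanism d}
    (h : ∀ᵐ θ : TypeSpace d ∂sphericalMeasure d, x.supp θ = F θ) : x.supp = F := by
  have h1 : (fun θ : TypeSpace d => x.supp θ) = fun θ : TypeSpace d => F θ :=
    Continuous.ext_on (dense_of_ae h) x.continuous_supp_coe (hF.comp continuous_subtype_val)
      fun θ hθ => hθ
  ext z
  by_cases hz : z = 0
  · have := hhom 0 le_rfl z
    rw [zero_smul, zero_mul] at this
    rw [hz, supp_zero, this]
  · rw [← norm_smul_dir hz, supp_smul _ (norm_nonneg _), hhom _ (norm_nonneg _)]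
    exact congrArg _ (congrFun h1 (dir hz))

theorem toL1_eq_iff [NeZero d] {x y : Mechanism d} : x.toL1 = y.toL1 ↔ x.supp = y.supp := by
  rw [toL1, toL1, MemLp.toLp_eq_toLp_iff]
  constructor
  · intro h
    refine supp_eq_of_ae y.supp_lipschitz.continuous (fun c hc z => y.supp_smul hc z) ?_
    filter_upwards [h] with θ hθ
    rw [supp_coe, supp_coe, hθ]
  · intro h
    filter_upwards [x.ae_uniqueAt] with θ hθ
    exact (alloc_eq_of_supp_eq h hθ).symm

/-- This turns the definition of an extreme point in `L¹` into an identity of support functions that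
holds everywhere, not only almost everywhere. -/
theorem supp_combination [NeZero d] {x y z : Mechanism d} {s t : ℝ}
    (h : s • x.toL1 + t • y.toL1 = z.toL1) (w : EuclideanSpace ℝ (Fin d)) :
    z.supp w = s * x.supp w + t * y.supp w := by
  have hz : z.supp = fun w => s * x.supp w + t * y.supp w := by
    refine supp_eq_of_ae ?_ (fun c hc z => ?_) ?_
    · have := x.supp_lipschitz.continuous
      have := y.supp_lipschitz.continuous
      fun_prop
    · rw [x.supp_smul hc, y.supp_smul hc]
      ring
    · have h1 : z.alloc =ᵐ[sphericalMeasure d] s • x.alloc + t • y.alloc := by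
        have hx : MemLp (s • x.alloc) 1 (sphericalMeasure d) := x.memLp_alloc.const_smul s
        have hy : MemLp (t • y.alloc) 1 (sphericalMeasure d) := y.memLp_alloc.const_smul t
        refine (MemLp.toLp_eq_toLp_iff z.memLp_alloc (hx.add hy)).1 ?_
        rw [MemLp.toLp_add hx hy, MemLp.toLp_const_smul s x.memLp_alloc,
          MemLp.toLp_const_smul t y.memLp_alloc]
        exact h.symm
      filter_upwards [h1] with θ hθ
      rw [supp_coe, hθ, supp_coe, supp_coe, Pi.add_apply, Pi.smul_apply, Pi.smul_apply,
        inner_add_left, inner_smul_left, inner_smul_left]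
      simp
  exact congrFun hz w

theorem toL1_combination {x y z : Mechanism d} {s t : ℝ}
    (h : ∀ θ, z.alloc θ = s • x.alloc θ + t • y.alloc θ) :
    s • x.toL1 + t • y.toL1 = z.toL1 := by
  have hx : MemLp (s • x.alloc) 1 (sphericalMeasure d) := x.memLp_alloc.const_smul s
  have hy : MemLp (t • y.alloc) 1 (sphericalMeasure d) := y.memLp_alloc.const_smul t
  have h1 := (MemLp.toLp_eq_toLp_iff z.memLp_alloc (hx.add hy)).2
    (Filter.Eventually.of_forall fun θ => by simpa using h θ)
  rw [MemLp.toLp_add hx hy, MemLp.toLp_const_smul s x.memLp_alloc,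
    MemLp.toLp_const_smul t y.memLp_alloc] at h1
  exact h1.symm

end Mechanism

/-! ### Finite menus and the essential menu -/

namespace Mechanism

variable {d : ℕ}

theorem exists_measurable_argmax (s : Finset (EuclideanSpace ℝ (Fin d))) (hs : s.Nonempty) :
    ∃ g : EuclideanSpace ℝ (Fin d) → EuclideanSpace ℝ (Fin d), Measurable g ∧
      ∀ z, g z ∈ s ∧ ∀ v ∈ s, inner ℝ v z ≤ inner ℝ (g z) z := by
  classical
  induction hs using Finset.Nonempty.cons_induction with
  | singleton a => exact ⟨fun _ => a, measurable_const, by simp⟩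
  | cons a s ha hs ih =>
    obtain ⟨g, hg, h⟩ := ih
    have hm : MeasurableSet {z | inner ℝ (g z) z ≤ inner ℝ a z} :=
      measurableSet_le (hg.inner measurable_id) (measurable_const.inner measurable_id)
    refine ⟨fun z => if inner ℝ (g z) z ≤ inner ℝ a z then a else g z,
      Measurable.ite hm measurable_const hg, fun z => ?_⟩
    obtain ⟨h1, h2⟩ := h z
    dsimp only
    split_ifs with hz
    · refine ⟨Finset.mem_cons_self a s, fun v hv => ?_⟩
      rcases Finset.mem_cons.1 hv with rfl | hv
      · exact le_rfl
      · exact (h2 v hv).trans hz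
    · refine ⟨Finset.mem_cons_of_mem h1, fun v hv => ?_⟩
      rcases Finset.mem_cons.1 hv with rfl | hv
      · exact (not_le.1 hz).le
      · exact h2 v hv

/-- Every nonempty finite family of lotteries can be offered as a menu. -/
theorem exists_of_finite {ι : Type*} [Finite ι] [Nonempty ι]
    (q : ι → EuclideanSpace ℝ (Fin d)) (hq : ∀ i, q i ∈ lotteries d) :
    ∃ y : Mechanism d, (∀ θ, ∃ i, y.alloc θ = q i) ∧
      ∀ θ : TypeSpace d, ∀ j, inner ℝ (q j) (θ : EuclideanSpace ℝ (Fin d)) ≤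
        inner ℝ (y.alloc θ) (θ : EuclideanSpace ℝ (Fin d)) := by
  obtain ⟨g, hg, h⟩ := exists_measurable_argmax (Set.finite_range q).toFinset
    ((Set.finite_range q).toFinset_nonempty.2 (Set.range_nonempty q))
  simp only [Set.Finite.mem_toFinset, Set.mem_range, forall_exists_index,
    forall_apply_eq_imp_iff] at h
  have hr : ∀ θ : TypeSpace d, ∃ i, g θ = q i := fun θ => by
    obtain ⟨i, hi⟩ := (h θ).1
    exact ⟨i, hi.symm⟩
  refine ⟨⟨fun θ => g θ, hg.comp measurable_subtype_coe, fun θ => ?_, fun θ θ' => ?_⟩, hr,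
    fun θ => (h θ).2⟩
  · obtain ⟨i, hi⟩ := hr θ
    rw [hi]
    exact hq i
  · obtain ⟨i, hi⟩ := hr θ'
    rw [hi]
    exact (h θ).2 i

theorem inner_le_supp_of_finite {ι : Type*} {q : ι → EuclideanSpace ℝ (Fin d)} {y : Mechanism d}
    (h : ∀ θ : TypeSpace d, ∀ j, inner ℝ (q j) (θ : EuclideanSpace ℝ (Fin d)) ≤
        inner ℝ (y.alloc θ) (θ : EuclideanSpace ℝ (Fin d)))
    (z : EuclideanSpace ℝ (Fin d)) (j : ι) : inner ℝ (q j) z ≤ y.supp z := by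
  by_cases hz : z = 0
  · simp [hz, supp_zero]
  · have := mul_le_mul_of_nonneg_left (h (dir hz) j) (norm_nonneg z)
    rwa [← inner_smul_right, ← supp_coe, ← supp_smul _ (norm_nonneg _), norm_smul_dir] at this

theorem exists_supp_eq_of_finite {ι : Type*} [Nonempty ι] {q : ι → EuclideanSpace ℝ (Fin d)}
    {y : Mechanism d} (h : ∀ θ, ∃ i, y.alloc θ = q i) (z : EuclideanSpace ℝ (Fin d)) :
    ∃ i, y.supp z = inner ℝ (q i) z := by
  by_cases hz : z = 0
  · exact ⟨Classical.arbitrary ι, by simp [hz, supp_zero]⟩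
  · obtain ⟨i, hi⟩ := h (dir hz)
    exact ⟨i, by rw [← hi, inner_dir]⟩

theorem alloc_mem_menu {x : Mechanism d} {θ : TypeSpace d} (hθ : x.UniqueAt θ) :
    x.alloc θ ∈ x.menu := by
  refine subset_closure (Set.mem_iInter.2 fun y => ⟨θ, ?_⟩)
  exact alloc_eq_of_supp_eq (payoffEquivalent_iff.1 y.2).symm hθ

theorem menu_subset {x y : Mechanism d} (h : x.supp = y.supp) {s : Set (EuclideanSpace ℝ (Fin d))}
    (hs : IsClosed s) (hy : ∀ θ, y.alloc θ ∈ s) : x.menu ⊆ s := by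
  refine closure_minimal ?_ hs
  refine (Set.iInter_subset _ ⟨y, payoffEquivalent_iff.2 h.symm⟩).trans ?_
  rintro _ ⟨θ, rfl⟩
  exact hy θ

theorem menu_subset_lotteries (x : Mechanism d) : x.menu ⊆ lotteries d :=
  menu_subset rfl isClosed_lotteries x.alloc_mem

theorem inner_le_supp_of_mem_menu {x : Mechanism d} {a : EuclideanSpace ℝ (Fin d)}
    (ha : a ∈ x.menu) (z : EuclideanSpace ℝ (Fin d)) : inner ℝ a z ≤ x.supp z :=
  menu_subset (s := {a | inner ℝ a z ≤ x.supp z}) rfl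
    (isClosed_le (by fun_prop) continuous_const) (fun θ => x.inner_le_supp θ z) ha

theorem isCompact_menu (x : Mechanism d) : IsCompact x.menu :=
  isCompact_lotteries.of_isClosed_subset isClosed_closure x.menu_subset_lotteries

/-- The types served optimally by the menu form the projection of a compact set, hence a closed set.
It contains the dense set of types with a unique optimum. -/
theorem exists_mem_menu_coe [NeZero d] (x : Mechanism d) (θ : TypeSpace d) :
    ∃ a ∈ x.menu, inner ℝ a (θ : EuclideanSpace ℝ (Fin d)) = x.supp θ := by
  have hcl : IsClosed {φ : TypeSpace d | ∃ a ∈ x.menu,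
      inner ℝ a (φ : EuclideanSpace ℝ (Fin d)) = x.supp φ} := by
    have h1 : IsClosed {p : EuclideanSpace ℝ (Fin d) × TypeSpace d | p.1 ∈ x.menu ∧
        inner ℝ p.1 (p.2 : EuclideanSpace ℝ (Fin d)) = x.supp p.2} := by
      refine (isClosed_closure.preimage continuous_fst).inter (isClosed_eq ?_ ?_)
      · fun_prop
      · exact x.continuous_supp_coe.comp continuous_snd
    have h2 : IsCompact {p : EuclideanSpace ℝ (Fin d) × TypeSpace d | p.1 ∈ x.menu ∧
        inner ℝ p.1 (p.2 : EuclideanSpace ℝ (Fin d)) = x.supp p.2} :=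
      (x.isCompact_menu.prod isCompact_univ).of_isClosed_subset h1 fun p hp => ⟨hp.1, trivial⟩
    convert (h2.image continuous_snd).isClosed using 1
    ext φ
    simp
  have hd := dense_of_ae x.ae_uniqueAt
  have : (θ : TypeSpace d) ∈ closure {φ | x.UniqueAt φ} := hd θ
  refine closure_minimal ?_ hcl this
  exact fun φ hφ => ⟨_, alloc_mem_menu hφ, (x.supp_coe φ).symm⟩

theorem exists_mem_menu [NeZero d] (x : Mechanism d) (z : EuclideanSpace ℝ (Fin d)) :
    ∃ a ∈ x.menu, inner ℝ a z = x.supp z := by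
  by_cases hz : z = 0
  · obtain ⟨a, ha, -⟩ := x.exists_mem_menu_coe (Classical.arbitrary _)
    exact ⟨a, ha, by simp [hz, supp_zero]⟩
  · obtain ⟨a, ha, h⟩ := x.exists_mem_menu_coe (dir hz)
    refine ⟨a, ha, ?_⟩
    rw [← norm_smul_dir hz, inner_smul_right, h, supp_smul _ (norm_nonneg _)]

theorem supp_facetNormal_le [NeZero d] (x : Mechanism d) (k : Fin (d + 1)) :
    x.supp (facetNormal k) ≤ facetOffset k := by
  have := mem_lotteries_iff.1 (x.alloc_mem (dir (facetNormal_ne_zero k))) k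
  rw [prob_eq, inner_dir] at this
  linarith

theorem grantsStrike_iff [NeZero d] {x : Mechanism d} :
    x.GrantsStrike ↔ ∀ k, x.supp (facetNormal k) = facetOffset k := by
  refine forall_congr' fun k => ⟨?_, fun h => ?_⟩
  · rintro ⟨a, ha, h⟩
    rw [prob_eq] at h
    linarith [inner_le_supp_of_mem_menu ha (facetNormal k), x.supp_facetNormal_le k]
  · obtain ⟨a, ha, h1⟩ := x.exists_mem_menu (facetNormal k)
    exact ⟨a, ha, by rw [prob_eq, h1, h, sub_self]⟩

theorem menu_eq_singleton_iff [NeZero d] {x : Mechanism d} {v : EuclideanSpace ℝ (Fin d)} :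
    x.menu = {v} ↔ ∀ z, x.supp z = inner ℝ v z := by
  constructor
  · intro h z
    obtain ⟨a, ha, h1⟩ := x.exists_mem_menu z
    rw [h, Set.mem_singleton_iff] at ha
    rw [← h1, ha]
  · intro h
    have hsub : x.menu ⊆ {v} := by
      refine menu_subset rfl isClosed_singleton fun θ => ?_
      have := x.inner_le_supp θ (x.alloc θ - v)
      rw [h, ← sub_nonpos, ← inner_sub_left] at this
      exact sub_eq_zero.1 (real_inner_self_nonpos.1 this)
    obtain ⟨a, ha, -⟩ := x.exists_mem_menu 0
    exact hsub.antisymm (Set.singleton_subset_iff.2 (hsub ha ▸ ha))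

/-- A mechanism whose uniquely optimal allocations lie in a finite set has its menu in that set. -/
theorem menu_subset_of_uniqueAt [NeZero d] {x : Mechanism d} {s : Set (EuclideanSpace ℝ (Fin d))}
    (hs : s.Finite) (h : ∀ θ, x.UniqueAt θ → x.alloc θ ∈ s) : x.menu ⊆ s := by
  have hd := dense_of_ae x.ae_uniqueAt
  have hsl : ∀ p : {p | ∃ θ, x.UniqueAt θ ∧ x.alloc θ = p}, (p : EuclideanSpace ℝ (Fin d)) ∈
      lotteries d := by
    rintro ⟨_, θ, -, rfl⟩
    exact x.alloc_mem θ
  have hfin : {p | ∃ θ, x.UniqueAt θ ∧ x.alloc θ = p}.Finite := by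
    refine hs.subset ?_
    rintro _ ⟨θ, hθ, rfl⟩
    exact h θ hθ
  have := hfin.to_subtype
  obtain ⟨θ₀, hθ₀⟩ := hd.nonempty
  have : Nonempty {p | ∃ θ, x.UniqueAt θ ∧ x.alloc θ = p} := ⟨⟨_, θ₀, hθ₀, rfl⟩⟩
  -- Offering exactly the uniquely optimal allocations gives a payoff-equivalent mechanism, whose
  -- range bounds the menu.
  obtain ⟨y, hy, hy'⟩ := exists_of_finite _ hsl
  have hsupp : x.supp = y.supp := by
    refine supp_eq_of_ae y.supp_lipschitz.continuous (fun c hc z => y.supp_smul hc z) ?_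
    filter_upwards [x.ae_uniqueAt] with θ hθ
    refine le_antisymm ?_ ?_
    · rw [supp_coe, supp_coe]
      exact hy' θ ⟨_, θ, hθ, rfl⟩
    · obtain ⟨⟨_, φ, hφ, rfl⟩, hp⟩ := hy θ
      rw [supp_coe y, hp]
      exact x.inner_le_supp φ θ
  refine menu_subset hsupp hs.isClosed fun θ => ?_
  obtain ⟨⟨_, φ, hφ, rfl⟩, hp⟩ := hy θ
  rw [hp]
  exact h φ hφ

theorem exists_uniqueAt_of_finite_menu [NeZero d] {x : Mechanism d} (h : x.menu.Finite)
    {p : EuclideanSpace ℝ (Fin d)} (hp : p ∈ x.menu) : ∃ θ, x.UniqueAt θ ∧ x.alloc θ = p := by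
  have hsub : {p | ∃ θ, x.UniqueAt θ ∧ x.alloc θ = p} ⊆ x.menu := by
    rintro _ ⟨θ, hθ, rfl⟩
    exact alloc_mem_menu hθ
  exact menu_subset_of_uniqueAt (h.subset hsub) (fun θ hθ => ⟨θ, hθ, rfl⟩) hp

/-- A mechanism with a menu of more than `n` points has `n + 1` types with uniquely optimal and
pairwise different allocations. -/
theorem exists_finset_uniqueAt [NeZero d] {x : Mechanism d} {n : ℕ}
    (h : ¬ x.menu.encard ≤ n) :
    ∃ s : Finset (TypeSpace d), s.card = n + 1 ∧ (∀ θ ∈ s, x.UniqueAt θ) ∧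
      Set.InjOn x.alloc s := by
  classical
  set V := {p | ∃ θ, x.UniqueAt θ ∧ x.alloc θ = p} with hV
  have hcard : ((n + 1 : ℕ) : ℕ∞) ≤ V.encard := by
    by_contra hlt
    have hlt' : V.encard < ((n + 1 : ℕ) : ℕ∞) := not_le.1 hlt
    have hfin : V.Finite := Set.finite_of_encard_le_coe hlt'.le
    have hsub := menu_subset_of_uniqueAt hfin (fun θ hθ => ⟨θ, hθ, rfl⟩)
    refine h ((Set.encard_le_encard hsub).trans ?_)
    rw [Nat.cast_add, Nat.cast_one] at hlt'
    exact Order.le_of_lt_add_one hlt'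
  obtain ⟨t, htV, htc⟩ := Set.exists_subset_encard_eq hcard
  have htfin : t.Finite := Set.finite_of_encard_eq_coe htc
  choose! g hg hg' using fun p (hp : p ∈ V) => hp
  have hinj : Set.InjOn g t := fun p hp q hq hpq => by
    rw [← hg' p (htV hp), ← hg' q (htV hq), hpq]
  refine ⟨htfin.toFinset.image g, ?_, ?_, ?_⟩
  · rw [Finset.card_image_of_injOn (by simpa using hinj)]
    rw [htfin.encard_eq_coe_toFinset_card] at htc
    exact_mod_cast htc
  · intro θ hθ
    simp only [Finset.mem_image, Set.Finite.mem_toFinset] at hθ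
    obtain ⟨p, hp, rfl⟩ := hθ
    exact hg p (htV hp)
  · intro θ hθ φ hφ heq
    simp only [Finset.coe_image, Set.Finite.coe_toFinset, Set.mem_image] at hθ hφ
    obtain ⟨p, hp, rfl⟩ := hθ
    obtain ⟨q, hq, rfl⟩ := hφ
    rw [hg' p (htV hp), hg' q (htV hq)] at heq
    rw [heq]

end Mechanism

/-! ### Summands of simplicial faces -/

section Rigidity

variable {E : Type*} [NormedAddCommGroup E] [InnerProductSpace ℝ E] {ι : Type*}

/-- The indices of the points of a family that are optimal in a given direction. -/
def argmaxSet (q : ι → E) (z : E) : Set ι :=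
  {i | ∀ j, inner ℝ (q j) z ≤ inner ℝ (q i) z}

theorem argmaxSet_nonempty [Finite ι] [Nonempty ι] (q : ι → E) (z : E) :
    (argmaxSet q z).Nonempty :=
  Finite.exists_max fun j => inner ℝ (q j) z

theorem inner_eq_of_mem_argmaxSet {q : ι → E} {z : E} {i j : ι} (hi : i ∈ argmaxSet q z)
    (hj : j ∈ argmaxSet q z) : inner ℝ (q i) z = inner ℝ (q j) z :=
  le_antisymm (hj i) (hi j)

theorem inner_lt_of_notMem_argmaxSet {q : ι → E} {z : E} {i j : ι} (hi : i ∈ argmaxSet q z)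
    (hj : j ∉ argmaxSet q z) : inner ℝ (q j) z < inner ℝ (q i) z := by
  refine lt_of_le_of_ne (hi j) fun h => hj fun k => ?_
  rw [h]
  exact hi k

/-- `f` sends the points of the family `q` to optimal points of another body: two points of `q` that
are optimal in the same direction have equally good images. -/
def IsSummand (q f : ι → E) : Prop :=
  ∀ z, ∀ i ∈ argmaxSet q z, ∀ j ∈ argmaxSet q z, inner ℝ (f i) z = inner ℝ (f j) z

/-- Points that are not optimal at `z` lose strictly there, so a small tilt of `z` only has to
respect the competition within the face. -/
theorem eventually_mem_argmaxSet [Finite ι] {q : ι → E} {z η : E} {i : ι}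
    (hi : i ∈ argmaxSet q z)
    (hη : ∀ k ∈ argmaxSet q z, inner ℝ (q k) η ≤ inner ℝ (q i) η) :
    ∀ᶠ ε : ℝ in 𝓝[>] 0, i ∈ argmaxSet q (z + ε • η) := by
  refine Filter.eventually_all.2 fun k => ?_
  by_cases hk : k ∈ argmaxSet q z
  · filter_upwards [self_mem_nhdsWithin] with ε hε
    rw [inner_add_right, inner_add_right, inner_smul_right, inner_smul_right,
      inner_eq_of_mem_argmaxSet hk hi]
    have := mul_le_mul_of_nonneg_left (hη k hk) (Set.mem_Ioi.1 hε).le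
    linarith
  · have hlt := inner_lt_of_notMem_argmaxSet hi hk
    have hc1 : Continuous fun ε : ℝ => inner ℝ (q k) (z + ε • η) := by fun_prop
    have hc2 : Continuous fun ε : ℝ => inner ℝ (q i) (z + ε • η) := by fun_prop
    have : ∀ᶠ ε : ℝ in 𝓝 0,
        inner ℝ (q k) (z + ε • η) < inner ℝ (q i) (z + ε • η) :=
      hc1.continuousAt.eventually_lt hc2.continuousAt (by simpa using hlt)
    exact (this.filter_mono nhdsWithin_le_nhds).mono fun ε hε => hε.le

/-- Tilting `z` slightly by `η` keeps both `i` and `j` optimal. Subtracting the summand identities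
at the original and the tilted direction isolates `η`. -/
theorem IsSummand.inner_eq_zero [Finite ι] {q f : ι → E} (h : IsSummand q f) {z η : E} {i j : ι}
    (hi : i ∈ argmaxSet q z) (hj : j ∈ argmaxSet q z)
    (hij : inner ℝ (q i) η = inner ℝ (q j) η)
    (hη : ∀ k ∈ argmaxSet q z, inner ℝ (q k) η ≤ inner ℝ (q i) η) :
    inner ℝ (f i - f j) η = 0 := by
  have hev := eventually_mem_argmaxSet hi hη
  obtain ⟨ε, hε, hpos⟩ := (hev.and self_mem_nhdsWithin).exists
  have hεj : j ∈ argmaxSet q (z + ε • η) := by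
    intro k
    refine (hε k).trans_eq ?_
    rw [inner_add_right, inner_add_right, inner_smul_right, inner_smul_right, hij,
      inner_eq_of_mem_argmaxSet hi hj]
  have h1 := h _ i hε j hεj
  have h2 := h _ i hi j hj
  rw [inner_add_right, inner_add_right, inner_smul_right, inner_smul_right, h2] at h1
  rw [inner_sub_left]
  have h3 : ε * (inner ℝ (f i) η - inner ℝ (f j) η) = 0 := by linarith
  exact (mul_eq_zero.1 h3).resolve_left (Set.mem_Ioi.1 hpos).ne'

theorem exists_inner_eq_of_linearIndependent [FiniteDimensional ℝ E] {κ : Type*} {b : κ → E}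
    (hb : LinearIndependent ℝ b) (c : κ → ℝ) : ∃ ξ : E, ∀ k, inner ℝ (b k) ξ = c k := by
  obtain ⟨φ, hφ⟩ := LinearMap.exists_extend ((Module.Basis.span hb).constr ℝ c)
  refine ⟨(InnerProductSpace.toDual ℝ E).symm φ.toContinuousLinearMap, fun k => ?_⟩
  rw [real_inner_comm, InnerProductSpace.toDual_symm_apply]
  have h1 : φ (b k) = (φ ∘ₗ (Submodule.span ℝ (Set.range b)).subtype) (Module.Basis.span hb k) := by
    simp [Module.Basis.span_apply]
  simp only [LinearMap.coe_toContinuousLinearMap']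
  rw [h1, hφ, Module.Basis.constr_basis]

theorem exists_smul_eq_of_forall_inner_eq_zero [FiniteDimensional ℝ E] {u v : E}
    (h : ∀ η, inner ℝ u η = 0 → inner ℝ v η = 0) : ∃ c : ℝ, v = c • u := by
  have hv : v ∈ (ℝ ∙ u)ᗮᗮ := by
    rw [Submodule.mem_orthogonal']
    intro η hη
    exact h η (Submodule.mem_orthogonal_singleton_iff_inner_right.1 hη)
  rw [Submodule.orthogonal_orthogonal] at hv
  obtain ⟨c, hc⟩ := Submodule.mem_span_singleton.1 hv
  exact ⟨c, hc.symm⟩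

/-- It suffices that `f i - f j` annihilates every `η` orthogonal to `q i - q j`. Affine
independence supplies `ξ` that makes the edge from `i` to `j` strictly optimal within the face. Both
`ξ` and `ξ + δ • η` are then admissible tilts for small `δ`, and their difference yields `η`. -/
theorem IsSummand.exists_smul [Finite ι] [FiniteDimensional ℝ E] {q f : ι → E}
    (h : IsSummand q f) {z : E}
    (hq : AffineIndependent ℝ fun i : argmaxSet q z => q i) {i j : ι}
    (hi : i ∈ argmaxSet q z) (hj : j ∈ argmaxSet q z) :
    ∃ c : ℝ, f i - f j = c • (q i - q j) := by
  refine exists_smul_eq_of_forall_inner_eq_zero fun η hη => ?_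
  have hli := (affineIndependent_iff_linearIndependent_vsub ℝ _ (⟨i, hi⟩ : argmaxSet q z)).1 hq
  classical
  obtain ⟨ξ, hξ⟩ := exists_inner_eq_of_linearIndependent hli
    fun k => if (k : argmaxSet q z) = ⟨j, hj⟩ then 0 else -1
  have hξ' : ∀ k ∈ argmaxSet q z, k ≠ i →
      inner ℝ (q k) ξ - inner ℝ (q i) ξ = if k = j then 0 else -1 := fun k hk hki => by
    have := hξ ⟨⟨k, hk⟩, by simpa using hki⟩
    rw [vsub_eq_sub, inner_sub_left] at this
    simpa using this
  have hξij : inner ℝ (q i) ξ = inner ℝ (q j) ξ := by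
    by_cases hij : j = i
    · rw [hij]
    · have := hξ' j hj hij
      simp only [if_true] at this
      linarith
  rw [inner_sub_left, sub_eq_zero] at hη
  have h0 : inner ℝ (f i - f j) ξ = 0 := by
    refine h.inner_eq_zero hi hj hξij fun k hk => ?_
    by_cases hki : k = i
    · rw [hki]
    · have := hξ' k hk hki
      split_ifs at this <;> linarith
  have hev : ∀ᶠ δ : ℝ in 𝓝[>] 0, ∀ k, k ∈ argmaxSet q z →
      inner ℝ (q k) (ξ + δ • η) ≤ inner ℝ (q i) (ξ + δ • η) := by
    refine Filter.eventually_all.2 fun k => ?_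
    by_cases hk : k ∈ argmaxSet q z
    · by_cases hki : k = i
      · exact Filter.Eventually.of_forall fun δ _ => by rw [hki]
      by_cases hkj : k = j
      · refine Filter.Eventually.of_forall fun δ _ => le_of_eq ?_
        rw [hkj, inner_add_right, inner_add_right, inner_smul_right, inner_smul_right, hη, hξij]
      have h1 := hξ' k hk hki
      rw [if_neg hkj] at h1
      have hc1 : Continuous fun δ : ℝ => inner ℝ (q k) (ξ + δ • η) := by fun_prop
      have hc2 : Continuous fun δ : ℝ => inner ℝ (q i) (ξ + δ • η) := by fun_prop
      have : ∀ᶠ δ : ℝ in 𝓝 0,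
          inner ℝ (q k) (ξ + δ • η) < inner ℝ (q i) (ξ + δ • η) :=
        hc1.continuousAt.eventually_lt hc2.continuousAt (by simp; linarith)
      exact (this.filter_mono nhdsWithin_le_nhds).mono fun δ hδ _ => hδ.le
    · exact Filter.Eventually.of_forall fun δ h => absurd h hk
  obtain ⟨δ, hδ, hpos⟩ := (hev.and self_mem_nhdsWithin).exists
  have h1 : inner ℝ (f i - f j) (ξ + δ • η) = 0 := by
    refine h.inner_eq_zero hi hj ?_ hδ
    rw [inner_add_right, inner_add_right, inner_smul_right, inner_smul_right, hη, hξij]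
  rw [inner_add_right, inner_smul_right, h0, zero_add] at h1
  exact (mul_eq_zero.1 h1).resolve_left (Set.mem_Ioi.1 hpos).ne'

/-- A simplicial face of a body is only decomposable into homothetic copies. -/
theorem IsSummand.exists_homothety [Finite ι] [FiniteDimensional ℝ E] {q f : ι → E}
    (h : IsSummand q f) {z : E} (hq : AffineIndependent ℝ fun i : argmaxSet q z => q i) :
    ∃ c : ℝ, ∀ i ∈ argmaxSet q z, ∀ j ∈ argmaxSet q z, f i - f j = c • (q i - q j) := by
  by_cases hsub : (argmaxSet q z).Subsingleton
  · exact ⟨0, fun i hi j hj => by rw [hsub hi hj, sub_self, zero_smul]⟩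
  obtain ⟨i₀, hi₀, j₀, hj₀, hne⟩ := Set.not_subsingleton_iff.1 hsub
  have hli := (affineIndependent_iff_linearIndependent_vsub ℝ _ (⟨i₀, hi₀⟩ : argmaxSet q z)).1 hq
  obtain ⟨c, hc⟩ := h.exists_smul hq hj₀ hi₀
  have key : ∀ k ∈ argmaxSet q z, f k - f i₀ = c • (q k - q i₀) := by
    intro k hk
    by_cases hki : k = i₀
    · rw [hki, sub_self, sub_self, smul_zero]
    by_cases hkj : k = j₀
    · rw [hkj, hc]
    obtain ⟨a, ha⟩ := h.exists_smul hq hk hi₀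
    obtain ⟨b, hb⟩ := h.exists_smul hq hk hj₀
    have hpair : LinearIndependent ℝ ![q k - q i₀, q j₀ - q i₀] := by
      have := hli.comp ![⟨⟨k, hk⟩, by simpa using hki⟩, ⟨⟨j₀, hj₀⟩, by simpa using hne.symm⟩] (by
        intro s t
        fin_cases s <;> fin_cases t <;> simp [hkj, Ne.symm hkj])
      rw [show (fun l : {l : argmaxSet q z // l ≠ ⟨i₀, hi₀⟩} => q l -ᵥ q i₀) ∘
          ![⟨⟨k, hk⟩, by simpa using hki⟩, ⟨⟨j₀, hj₀⟩, by simpa using hne.symm⟩] =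
          ![q k - q i₀, q j₀ - q i₀] by ext s; fin_cases s <;> rfl] at this
      exact this
    rw [LinearIndependent.pair_iff] at hpair
    -- The edges of the triangle `i₀`, `j₀`, `k` have ratios `a`, `b`, `c`. Its image closes up, and
    -- two independent sides force the ratios to agree.
    have heq : (a - b) • (q k - q i₀) + (b - c) • (q j₀ - q i₀) = 0 := by
      have : f k - f i₀ - (f j₀ - f i₀) = f k - f j₀ := by abel
      rw [ha, hb, hc] at this
      rw [← sub_eq_zero] at this
      rw [← this]
      module
    obtain ⟨h1, h2⟩ := hpair _ _ heq
    rw [ha, sub_eq_zero.1 h1, sub_eq_zero.1 h2]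
  refine ⟨c, fun i hi j hj => ?_⟩
  have : f i - f j = (f i - f i₀) - (f j - f i₀) := by abel
  rw [this, key i hi, key j hj, ← smul_sub]
  congr 1
  abel

end Rigidity

/-! ### Connectedness of spheres and boundaries with points removed -/

section Connectedness

variable {E : Type*} [NormedAddCommGroup E]

/-- A locally constant labelling of a finite closed cover of a connected set is constant. -/
theorem eq_of_finite_closed_cover {X : Type*} [TopologicalSpace X] {S : Set X}
    (hS : IsPreconnected S) {κ α : Type*} [Finite κ] {C : κ → Set X} (hC : ∀ k, IsClosed (C k))
    (hcover : S ⊆ ⋃ k, C k) (g : κ → α)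
    (hg : ∀ k l, (S ∩ (C k ∩ C l)).Nonempty → g k = g l) {k l : κ}
    (hk : (S ∩ C k).Nonempty) (hl : (S ∩ C l).Nonempty) : g k = g l := by
  by_contra hne
  have h := isPreconnected_closed_iff.1 hS (⋃ j : {j // g j = g k}, C j)
    (⋃ j : {j // g j ≠ g k}, C j) (isClosed_iUnion_of_finite fun j => hC j)
    (isClosed_iUnion_of_finite fun j => hC j) ?_ ?_ ?_
  · obtain ⟨p, hp, hp1, hp2⟩ := h
    obtain ⟨⟨i, hi⟩, hpi⟩ := Set.mem_iUnion.1 hp1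
    obtain ⟨⟨j, hj⟩, hpj⟩ := Set.mem_iUnion.1 hp2
    exact hj ((hg i j ⟨p, hp, hpi, hpj⟩).symm.trans hi)
  · intro p hp
    obtain ⟨j, hj⟩ := Set.mem_iUnion.1 (hcover hp)
    by_cases hgj : g j = g k
    · exact Or.inl (Set.mem_iUnion.2 ⟨⟨j, hgj⟩, hj⟩)
    · exact Or.inr (Set.mem_iUnion.2 ⟨⟨j, hgj⟩, hj⟩)
  · obtain ⟨p, hp, hpk⟩ := hk
    exact ⟨p, hp, Set.mem_iUnion.2 ⟨⟨k, rfl⟩, hpk⟩⟩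
  · obtain ⟨p, hp, hpl⟩ := hl
    exact ⟨p, hp, Set.mem_iUnion.2 ⟨⟨l, fun h => hne h.symm⟩, hpl⟩⟩

/-- Stereographic projection from the removed point `v` maps the rest onto `ℝⁿ` minus a countable
set, which is path-connected for `n ≥ 2`. -/
theorem isPreconnected_sphere_diff [InnerProductSpace ℝ E] {n : ℕ} (hn : 2 ≤ n)
    [Fact (Module.finrank ℝ E = n + 1)] {S : Set E} (hS : S.Countable) {v : E}
    (hv : v ∈ Metric.sphere (0 : E) 1) (hvS : v ∈ S) :
    IsPreconnected (Metric.sphere (0 : E) 1 \ S) := by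
  set e := stereographic' n (⟨v, hv⟩ : Metric.sphere (0 : E) 1) with he
  set T : Set (EuclideanSpace ℝ (Fin n)) := {t | ((e.symm t : Metric.sphere (0 : E) 1) : E) ∈ S}
  have hT : T.Countable := by
    have : (((↑) : Metric.sphere (0 : E) 1 → E) ⁻¹' S).Countable :=
      hS.preimage Subtype.val_injective
    refine Set.Countable.mono (fun t ht => ?_) (this.image e)
    refine ⟨e.symm t, ht, e.right_inv ?_⟩
    simp [he]
  have hrank : 1 < Module.rank ℝ (EuclideanSpace ℝ (Fin n)) := by
    rw [rank_eq_card_basis (EuclideanSpace.basisFun (Fin n) ℝ).toBasis, Fintype.card_fin]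
    exact_mod_cast hn
  have hconn := (hT.isPathConnected_compl_of_one_lt_rank hrank).isConnected.isPreconnected
  have hcont : Continuous e.symm := by
    rw [← continuousOn_univ]
    have := e.continuousOn_symm
    rwa [he, stereographic'_target] at this
  have himg : (fun t => ((e.symm t : Metric.sphere (0 : E) 1) : E)) '' Tᶜ =
      Metric.sphere (0 : E) 1 \ S := by
    ext p
    constructor
    · rintro ⟨t, ht, rfl⟩
      exact ⟨(e.symm t).2, ht⟩
    · rintro ⟨hp, hpS⟩
      have hsrc : (⟨p, hp⟩ : Metric.sphere (0 : E) 1) ∈ e.source := by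
        rw [he, stereographic'_source]
        intro h
        rw [Set.mem_singleton_iff, Subtype.mk.injEq] at h
        exact hpS (h ▸ hvS)
      refine ⟨e ⟨p, hp⟩, ?_, ?_⟩
      · change ((e.symm (e ⟨p, hp⟩) : Metric.sphere (0 : E) 1) : E) ∉ S
        rwa [e.left_inv hsrc]
      · change ((e.symm (e ⟨p, hp⟩) : Metric.sphere (0 : E) 1) : E) = p
        rw [e.left_inv hsrc]
  rw [← himg]
  exact hconn.image _ (continuous_subtype_val.comp hcont).continuousOn

theorem isPreconnected_frontier [NormedSpace ℝ E] (hrank : 1 < Module.rank ℝ E) {P : Set E}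
    (hc : Convex ℝ P) (hne : (interior P).Nonempty) (hb : Bornology.IsBounded P) :
    IsPreconnected (frontier P) := by
  obtain ⟨h, -, -, hf⟩ := exists_homeomorph_image_interior_closure_frontier_eq_unitBall hc hne hb
  have : frontier P = h.symm '' Metric.sphere 0 1 := by
    rw [← hf, ← Set.image_comp]
    simp
  rw [this]
  exact (isPreconnected_sphere hrank 0 1).image _ h.symm.continuous.continuousOn

theorem isPreconnected_frontier_diff [InnerProductSpace ℝ E] {n : ℕ} (hn : 2 ≤ n)
    [Fact (Module.finrank ℝ E = n + 1)] {P : Set E}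
    (hc : Convex ℝ P) (hne : (interior P).Nonempty) (hb : Bornology.IsBounded P)
    {S : Set E} (hS : S.Countable) {v : E} (hv : v ∈ frontier P) (hvS : v ∈ S) :
    IsPreconnected (frontier P \ S) := by
  obtain ⟨h, -, -, hf⟩ := exists_homeomorph_image_interior_closure_frontier_eq_unitBall hc hne hb
  have h1 : frontier P \ S = h.symm '' (Metric.sphere 0 1 \ h '' S) := by
    rw [← hf, ← Set.image_sdiff h.injective, ← Set.image_comp]
    simp
  rw [h1]
  refine (isPreconnected_sphere_diff hn (hS.image h) (v := h v) ?_
    (Set.mem_image_of_mem h hvS)).image _ h.symm.continuous.continuousOn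
  rw [← hf]
  exact Set.mem_image_of_mem h hv

end Connectedness

/-! ### Indecomposability of simplicial polytopes -/

section SimplicialPolytope

variable {E : Type*} [NormedAddCommGroup E] [InnerProductSpace ℝ E] {ι : Type*}

theorem exists_weights_of_mem_convexHull [Fintype ι] {q : ι → E} {J : Set ι} {p : E}
    (hp : p ∈ convexHull ℝ (q '' J)) :
    ∃ w : ι → ℝ, (∀ i, 0 ≤ w i) ∧ ∑ i, w i = 1 ∧ (∀ i, i ∉ J → w i = 0) ∧
      ∑ i, w i • q i = p := by
  classical
  refine convexHull_min (t := {p | ∃ w : ι → ℝ, (∀ i, 0 ≤ w i) ∧ ∑ i, w i = 1 ∧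
    (∀ i, i ∉ J → w i = 0) ∧ ∑ i, w i • q i = p}) ?_ ?_ hp
  · rintro _ ⟨i, hi, rfl⟩
    refine ⟨Pi.single i 1, fun j => ?_, by simp, fun j hj => ?_, ?_⟩
    · by_cases hji : j = i
      · subst hji
        simp
      · simp [hji]
    · exact Pi.single_eq_of_ne (fun h : j = i => hj (h ▸ hi)) _
    · simp [Pi.single_apply]
  · rintro _ ⟨w, hw0, hw1, hwJ, rfl⟩ _ ⟨u, hu0, hu1, huJ, rfl⟩ a b ha hb hab
    refine ⟨fun i => a * w i + b * u i, fun i => ?_, ?_, fun i hi => ?_, ?_⟩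
    · exact add_nonneg (mul_nonneg ha (hw0 i)) (mul_nonneg hb (hu0 i))
    · rw [Finset.sum_add_distrib, ← Finset.mul_sum, ← Finset.mul_sum, hw1, hu1, mul_one, mul_one,
        hab]
    · change a * w i + b * u i = 0
      rw [hwJ i hi, huJ i hi, mul_zero, mul_zero, add_zero]
    · simp only [add_smul, mul_smul, Finset.sum_add_distrib, Finset.smul_sum]

/-- An optimal point of a polytope is a convex combination of optimal generators. -/
theorem mem_convexHull_inter_argmaxSet [Finite ι] {q : ι → E} {J : Set ι} {p z : E}
    (hp : p ∈ convexHull ℝ (q '' J)) (hz : ∀ j, inner ℝ (q j) z ≤ inner ℝ p z) :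
    p ∈ convexHull ℝ (q '' (J ∩ argmaxSet q z)) := by
  classical
  have := Fintype.ofFinite ι
  obtain ⟨w, hw0, hw1, hwJ, rfl⟩ := exists_weights_of_mem_convexHull hp
  set p := ∑ i, w i • q i with hpdef
  -- A weighted sum of nonnegative losses vanishes, so positive weight falls only on optimal
  -- generators.
  have hsum : ∑ i, w i * (inner ℝ p z - inner ℝ (q i) z) = 0 := by
    simp only [mul_sub, Finset.sum_sub_distrib, ← Finset.sum_mul, hw1, one_mul]
    rw [hpdef, sum_inner]
    simp [inner_smul_left]
  have hzero := (Finset.sum_eq_zero_iff_of_nonneg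
    fun i _ => mul_nonneg (hw0 i) (sub_nonneg.2 (hz i))).1 hsum
  have hsupp : ∀ i, w i ≠ 0 → i ∈ J ∩ argmaxSet q z := by
    intro i hi
    refine ⟨by_contra fun h => hi (hwJ i h), fun j => ?_⟩
    have := (mul_eq_zero.1 (hzero i (Finset.mem_univ i))).resolve_left hi
    exact (hz j).trans (sub_eq_zero.1 this).le
  have h1 : ∑ i with w i ≠ 0, w i • q i = p := by
    rw [hpdef, Finset.sum_filter]
    refine Finset.sum_congr rfl fun i _ => ?_
    split_ifs with h
    · rfl
    · rw [not_not.1 h, zero_smul]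
  have h2 : ∑ i with w i ≠ 0, w i = 1 := by
    rw [Finset.sum_filter_ne_zero, hw1]
  rw [← h1]
  refine (convex_convexHull ℝ _).sum_mem (fun i _ => hw0 i) h2 fun i hi => ?_
  exact subset_convexHull ℝ _ ⟨i, hsupp i (Finset.mem_filter.1 hi).2, rfl⟩

theorem inner_le_of_mem_convexHull {s : Set E} {z : E} {c : ℝ} (hs : ∀ a ∈ s, inner ℝ a z ≤ c)
    {p : E} (hp : p ∈ convexHull ℝ s) : inner ℝ p z ≤ c := by
  refine convexHull_min (t := {p | inner ℝ p z ≤ c}) hs ?_ hp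
  exact convex_halfSpace_le
    ⟨fun a b => inner_add_left a b z, fun r a => by simp [inner_smul_left]⟩ c

theorem notMem_interior_of_inner_le {P : Set E} {p z : E} (hz : z ≠ 0)
    (h : ∀ a ∈ P, inner ℝ a z ≤ inner ℝ p z) : p ∉ interior P := by
  intro hp
  have hc : Continuous fun ε : ℝ => p + ε • z := by fun_prop
  have hev : ∀ᶠ ε : ℝ in 𝓝 0, p + ε • z ∈ P :=
    (hc.tendsto' 0 p (by simp)).eventually (mem_interior_iff_mem_nhds.1 hp)
  obtain ⟨ε, hε, hpos⟩ :=
    ((hev.filter_mono nhdsWithin_le_nhds).and (self_mem_nhdsWithin (s := Set.Ioi 0))).exists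
  have := h _ hε
  rw [inner_add_left, inner_smul_left, RCLike.conj_to_real] at this
  have h2 := mul_pos (Set.mem_Ioi.1 hpos) (real_inner_self_pos.2 hz)
  linarith

/-- Separate `p` from the open interior. The inequality passes to the closure, which contains `P`.
-/
theorem exists_supporting_direction [FiniteDimensional ℝ E] {P : Set E} (hc : Convex ℝ P)
    (hne : (interior P).Nonempty) {p : E} (hp : p ∉ interior P) :
    ∃ z : E, z ≠ 0 ∧ ∀ a ∈ P, inner ℝ a z ≤ inner ℝ p z := by
  obtain ⟨φ, hφ⟩ := geometric_hahn_banach_open_point hc.interior isOpen_interior hp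
  have hin : ∀ a, inner ℝ a ((InnerProductSpace.toDual ℝ E).symm φ) = φ a := fun a => by
    rw [real_inner_comm, InnerProductSpace.toDual_symm_apply]
  refine ⟨(InnerProductSpace.toDual ℝ E).symm φ, fun h => ?_, fun a ha => ?_⟩
  · obtain ⟨o, ho⟩ := hne
    have := hφ o ho
    rw [← hin, ← hin, h, inner_zero_right, inner_zero_right] at this
    exact lt_irrefl _ this
  · rw [hin, hin]
    have hcl : a ∈ closure (interior P) := by
      rw [hc.closure_interior_eq_closure_of_nonempty_interior hne]
      exact subset_closure ha
    exact closure_minimal (t := {a | φ a ≤ φ p}) (fun b hb => (hφ b hb).le)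
      (isClosed_le φ.continuous continuous_const) hcl

theorem midpoint_ne_of_affineIndependent [FiniteDimensional ℝ E] {κ : Type*} {q : κ → E}
    (hq : AffineIndependent ℝ q) {i j : κ} (hij : i ≠ j) (k : κ) :
    (2⁻¹ : ℝ) • (q i + q j) ≠ q k := by
  intro h
  obtain ⟨ξ, hξ⟩ := exists_inner_eq_of_linearIndependent
    ((affineIndependent_iff_linearIndependent_vsub ℝ _ k).1 hq) fun _ => 1
  have hξ' : ∀ l, l ≠ k → inner ℝ (q l) ξ - inner ℝ (q k) ξ = 1 := fun l hl => by
    have := hξ ⟨l, hl⟩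
    rwa [vsub_eq_sub, inner_sub_left] at this
  have h1 : 2⁻¹ * (inner ℝ (q i) ξ + inner ℝ (q j) ξ) = inner ℝ (q k) ξ := by
    rw [← h, inner_smul_left, inner_add_left]
    simp
  by_cases hi : i = k
  · have := hξ' j (fun h => hij (hi.trans h.symm))
    rw [hi] at h1
    linarith
  · have h2 := hξ' i hi
    by_cases hj : j = k
    · rw [hj] at h1
      linarith
    · have := hξ' j hj
      linarith

/-- In dimension at least three, a full-dimensional polytope all of whose proper faces are simplices
only decomposes into homothetic copies. -/
theorem IsSummand.exists_global_homothety {n : ℕ} (hn : 2 ≤ n)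
    [Fact (Module.finrank ℝ E = n + 1)] [Finite ι] [Nonempty ι] {q f : ι → E}
    (h : IsSummand q f)
    (hq : ∀ z, z ≠ 0 → AffineIndependent ℝ fun i : argmaxSet q z => q i)
    (hint : (interior (convexHull ℝ (Set.range q))).Nonempty) :
    ∃ (c : ℝ) (t : E), ∀ z, z ≠ 0 → ∀ i ∈ argmaxSet q z, f i = c • q i + t := by
  have hfd : FiniteDimensional ℝ E :=
    Module.finite_of_finrank_pos (by rw [Fact.out (p := Module.finrank ℝ E = n + 1)]; omega)
  have hrank : 1 < Module.rank ℝ E := by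
    rw [← Module.finrank_eq_rank, Fact.out (p := Module.finrank ℝ E = n + 1)]
    exact_mod_cast (by omega : 1 < n + 1)
  have hnt : Nontrivial E := Module.nontrivial_of_finrank_pos (R := ℝ)
    (by rw [Fact.out (p := Module.finrank ℝ E = n + 1)]; omega)
  set P := convexHull ℝ (Set.range q) with hP
  have hPc : Convex ℝ P := convex_convexHull ℝ _
  have hPcomp : IsCompact P := (Set.finite_range q).isCompact_convexHull (𝕜 := ℝ)
  have hPb := hPcomp.isBounded
  have hfr : ∀ p, p ∈ frontier P ↔ p ∈ P ∧ p ∉ interior P := fun p => by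
    rw [hPcomp.isClosed.frontier_eq, Set.mem_sdiff]
  -- Proper faces, indexed by their sets of generators. This type is finite, as required for a
  -- finite closed cover of the boundary.
  let κ := {J : Set ι // ∃ z, z ≠ 0 ∧ J = argmaxSet q z}
  let C : κ → Set E := fun J => convexHull ℝ (q '' J.1)
  have hCcl : ∀ J, IsClosed (C J) := fun J =>
    ((Set.toFinite J.1).image q).isCompact_convexHull (𝕜 := ℝ).isClosed
  have hCP : ∀ J, C J ⊆ P := fun J => convexHull_mono (Set.image_subset_range _ _)
  have hCopt : ∀ J : κ, ∀ z, J.1 = argmaxSet q z → ∀ p ∈ C J, ∀ j, inner ℝ (q j) z ≤ inner ℝ p z := by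
    intro J z hJ p hp j
    have h1 : inner ℝ p (-z) ≤ - inner ℝ (q j) z := by
      refine inner_le_of_mem_convexHull ?_ hp
      rintro _ ⟨i, hi, rfl⟩
      rw [hJ] at hi
      rw [inner_neg_right]
      exact neg_le_neg (hi j)
    rw [inner_neg_right] at h1
    linarith
  have hCfr : ∀ J, C J ⊆ frontier P := by
    intro J p hp
    obtain ⟨z, hz, hJ⟩ := J.2
    refine (hfr p).2 ⟨hCP J hp, notMem_interior_of_inner_le hz fun a ha => ?_⟩
    refine inner_le_of_mem_convexHull ?_ ha
    rintro _ ⟨j, rfl⟩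
    exact hCopt J z hJ p hp j
  have hcover : frontier P ⊆ ⋃ J, C J := by
    intro p hp
    obtain ⟨hpP, hpi⟩ := (hfr p).1 hp
    obtain ⟨z, hz, hsup⟩ := exists_supporting_direction hPc hint hpi
    refine Set.mem_iUnion.2 ⟨⟨argmaxSet q z, z, hz, rfl⟩, ?_⟩
    have := mem_convexHull_inter_argmaxSet (J := Set.univ) (by rwa [Set.image_univ])
      fun j => hsup (q j) (subset_convexHull ℝ _ ⟨j, rfl⟩)
    rwa [Set.univ_inter] at this
  have hinter : ∀ J K : κ, ∀ p, p ∈ C J → p ∈ C K → p ∈ convexHull ℝ (q '' (J.1 ∩ K.1)) := by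
    intro J K p hJ hK
    obtain ⟨z, hz, hKz⟩ := K.2
    rw [hKz]
    exact mem_convexHull_inter_argmaxSet hJ (hCopt K z hKz p hK)
  have hJne : ∀ J : κ, J.1.Nonempty := by
    intro J
    obtain ⟨z, hz, hJ⟩ := J.2
    rw [hJ]
    exact argmaxSet_nonempty q z
  have hqC : ∀ J : κ, ∀ i ∈ J.1, q i ∈ C J := fun J i hi => subset_convexHull ℝ _ ⟨i, hi, rfl⟩
  have hind : ∀ J : κ, AffineIndependent ℝ fun i : J.1 => q i := by
    rintro ⟨_, z, hz, rfl⟩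
    exact hq z hz
  have hhom : ∀ J : κ, ∃ c : ℝ, ∀ i ∈ J.1, ∀ j ∈ J.1, f i - f j = c • (q i - q j) := by
    rintro ⟨_, z, hz, rfl⟩
    exact h.exists_homothety (hq z hz)
  choose g hg using hhom
  -- Dimension at least three is used here: removing the generators does not disconnect the
  -- boundary.
  have hX : IsPreconnected (frontier P \ Set.range q) := by
    obtain ⟨z, hz⟩ := exists_ne (0 : E)
    obtain ⟨i, hi⟩ := argmaxSet_nonempty q z
    exact isPreconnected_frontier_diff hn hPc hint hPb (Set.finite_range q).countable
      (hCfr ⟨_, z, hz, rfl⟩ (hqC _ i hi)) ⟨i, rfl⟩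
  have hmeet : ∀ J : κ, ∀ i ∈ J.1, ∀ j ∈ J.1, i ≠ j →
      ((frontier P \ Set.range q) ∩ C J).Nonempty := by
    intro J i hi j hj hij
    have hm : (2⁻¹ : ℝ) • (q i + q j) ∈ C J := by
      rw [smul_add]
      exact convex_convexHull ℝ _ (hqC J i hi) (hqC J j hj) (by norm_num) (by norm_num)
        (by norm_num)
    refine ⟨_, ⟨hCfr J hm, ?_⟩, hm⟩
    rintro ⟨k, hk⟩
    have hkJ : k ∈ J.1 := by
      obtain ⟨z, hz, hJ⟩ := J.2
      rw [hJ]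
      intro l
      rw [hk]
      exact hCopt J z hJ _ hm l
    exact midpoint_ne_of_affineIndependent (hind J) (i := ⟨i, hi⟩) (j := ⟨j, hj⟩)
      (by simpa using hij) ⟨k, hkJ⟩ hk.symm
  have hgconst : ∀ J K : κ, ((frontier P \ Set.range q) ∩ C J).Nonempty →
      ((frontier P \ Set.range q) ∩ C K).Nonempty → g J = g K := by
    intro J K hJ hK
    refine eq_of_finite_closed_cover hX hCcl (Set.sdiff_subset.trans hcover) g ?_ hJ hK
    rintro J K ⟨p, ⟨-, hpq⟩, hpJ, hpK⟩
    have hpJK := hinter J K p hpJ hpK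
    -- Two faces that meet at a point that is not a generator share at least two generators. The
    -- common edge transmits the ratio.
    have hns : ¬ (J.1 ∩ K.1).Subsingleton := by
      intro hsub
      rcases hsub.eq_empty_or_singleton with h0 | ⟨i, hi⟩
      · rw [h0, Set.image_empty, convexHull_empty] at hpJK
        exact hpJK
      · rw [hi, Set.image_singleton, convexHull_singleton] at hpJK
        exact hpq ⟨i, hpJK.symm⟩
    obtain ⟨i, ⟨hiJ, hiK⟩, j, ⟨hjJ, hjK⟩, hij⟩ := Set.not_subsingleton_iff.1 hns
    have h1 := (hg J i hiJ j hjJ).symm.trans (hg K i hiK j hjK)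
    have hne : q i - q j ≠ 0 := by
      rw [sub_ne_zero]
      intro hqq
      have := (hind J).injective (a₁ := ⟨i, hiJ⟩) (a₂ := ⟨j, hjJ⟩) hqq
      exact hij (congrArg Subtype.val this)
    exact smul_left_injective ℝ hne h1
  obtain ⟨c, hc⟩ : ∃ c : ℝ, ∀ J : κ, ∀ i ∈ J.1, ∀ j ∈ J.1, f i - f j = c • (q i - q j) := by
    by_cases hex : ∃ J : κ, ((frontier P \ Set.range q) ∩ C J).Nonempty
    · obtain ⟨J, hJ⟩ := hex
      refine ⟨g J, fun K i hi j hj => ?_⟩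
      by_cases hij : i = j
      · rw [hij, sub_self, sub_self, smul_zero]
      · rw [hgconst J K hJ (hmeet K i hi j hj hij), hg K i hi j hj]
    -- In this case no face has two generators, so any ratio works.
    · refine ⟨0, fun K i hi j hj => ?_⟩
      by_cases hij : i = j
      · rw [hij, sub_self, sub_self, smul_zero]
      · exact absurd ⟨K, hmeet K i hi j hj hij⟩ hex
  choose r hr using hJne
  have htr : ∀ J : κ, ∀ i ∈ J.1, f i - c • q i = f (r J) - c • q (r J) := by
    intro J i hi
    have := hc J i hi (r J) (hr J)
    rw [smul_sub] at this
    rw [sub_eq_sub_iff_sub_eq_sub, this]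
  -- With a global ratio, `f - c • q` is constant on each face, and one shared generator suffices to
  -- compare faces. The full boundary can be used now.
  have hconst : ∀ J K : κ, f (r J) - c • q (r J) = f (r K) - c • q (r K) := by
    intro J K
    refine eq_of_finite_closed_cover (isPreconnected_frontier hrank hPc hint hPb) hCcl hcover
      (fun J => f (r J) - c • q (r J)) ?_ ⟨_, hCfr J (hqC J _ (hr J)), hqC J _ (hr J)⟩
      ⟨_, hCfr K (hqC K _ (hr K)), hqC K _ (hr K)⟩
    rintro J K ⟨p, -, hpJ, hpK⟩
    have hpJK := hinter J K p hpJ hpK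
    have : (J.1 ∩ K.1).Nonempty := by
      rw [Set.nonempty_iff_ne_empty]
      intro h0
      rw [h0, Set.image_empty, convexHull_empty] at hpJK
      exact hpJK
    obtain ⟨i, hiJ, hiK⟩ := this
    exact (htr J i hiJ).symm.trans (htr K i hiK)
  obtain ⟨z₀, hz₀⟩ := exists_ne (0 : E)
  let J₀ : κ := ⟨argmaxSet q z₀, z₀, hz₀, rfl⟩
  refine ⟨c, f (r J₀) - c • q (r J₀), fun z hz i hi => ?_⟩
  rw [hconst J₀ ⟨_, z, hz, rfl⟩, ← htr ⟨_, z, hz, rfl⟩ i hi]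
  abel

end SimplicialPolytope

/-! ### Exposed vertices -/

section Exposed

variable {E : Type*} [NormedAddCommGroup E] [InnerProductSpace ℝ E] {ι : Type*}

/-- The vertices of a simplicial face are exposed. -/
theorem exists_argmaxSet_eq_singleton [Finite ι] [FiniteDimensional ℝ E] [Nontrivial E]
    {q : ι → E} {z : E} (hq : AffineIndependent ℝ fun i : argmaxSet q z => q i) {i : ι}
    (hi : i ∈ argmaxSet q z) : ∃ w, w ≠ 0 ∧ argmaxSet q w = {i} := by
  obtain ⟨ξ, hξ⟩ := exists_inner_eq_of_linearIndependent
    ((affineIndependent_iff_linearIndependent_vsub ℝ _ (⟨i, hi⟩ : argmaxSet q z)).1 hq)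
    fun _ => -1
  have hξ' : ∀ k ∈ argmaxSet q z, k ≠ i → inner ℝ (q k) ξ - inner ℝ (q i) ξ = -1 :=
    fun k hk hki => by
      have := hξ ⟨⟨k, hk⟩, by simpa using hki⟩
      rwa [vsub_eq_sub, inner_sub_left] at this
  have hev : ∀ᶠ ε : ℝ in 𝓝[>] 0, ∀ k, k ∉ argmaxSet q z →
      inner ℝ (q k) (z + ε • ξ) < inner ℝ (q i) (z + ε • ξ) := by
    refine Filter.eventually_all.2 fun k => ?_
    by_cases hk : k ∈ argmaxSet q z
    · exact Filter.Eventually.of_forall fun ε h => absurd hk h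
    · have hlt := inner_lt_of_notMem_argmaxSet hi hk
      have hc1 : Continuous fun ε : ℝ => inner ℝ (q k) (z + ε • ξ) := by fun_prop
      have hc2 : Continuous fun ε : ℝ => inner ℝ (q i) (z + ε • ξ) := by fun_prop
      have : ∀ᶠ ε : ℝ in 𝓝 0,
          inner ℝ (q k) (z + ε • ξ) < inner ℝ (q i) (z + ε • ξ) :=
        hc1.continuousAt.eventually_lt hc2.continuousAt (by simpa using hlt)
      exact (this.filter_mono nhdsWithin_le_nhds).mono fun ε hε _ => hε
  obtain ⟨ε, hε, hpos⟩ := (hev.and self_mem_nhdsWithin).exists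
  have hlt : ∀ k, k ≠ i → inner ℝ (q k) (z + ε • ξ) < inner ℝ (q i) (z + ε • ξ) := by
    intro k hki
    by_cases hk : k ∈ argmaxSet q z
    · rw [inner_add_right, inner_add_right, inner_smul_right, inner_smul_right,
        inner_eq_of_mem_argmaxSet hk hi]
      have h1 := hξ' k hk hki
      have h2 : 0 < ε := hpos
      nlinarith
    · exact hε k hk
  -- The tilted direction can vanish only if `i` is the sole index. Every nonzero direction then
  -- exposes it.
  by_cases h0 : z + ε • ξ = 0
  · have honly : ∀ k, k = i := fun k => by
      by_contra hki
      have := hlt k hki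
      rw [h0, inner_zero_right, inner_zero_right] at this
      exact lt_irrefl _ this
    obtain ⟨w, hw⟩ := exists_ne (0 : E)
    refine ⟨w, hw, Set.eq_singleton_iff_unique_mem.2 ⟨fun k => ?_, fun k _ => honly k⟩⟩
    rw [honly k]
  · refine ⟨_, h0, Set.eq_singleton_iff_unique_mem.2 ⟨fun k => ?_, fun k hk => ?_⟩⟩
    · by_cases hki : k = i
      · rw [hki]
      · exact (hlt k hki).le
    · by_contra hki
      exact absurd (hk i) (not_le.2 (hlt k hki))

end Exposed

/-! ### Rigid bodies that touch all facets are extreme -/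

namespace Mechanism

variable {d : ℕ}

/-- The vertices of a polytopal menu decompose along with the menu. -/
theorem supp_eq_of_mem_argmaxSet {ι : Type*} [Finite ι] {x y w : Mechanism d} {s t : ℝ}
    (hs : 0 < s) (ht : 0 < t) (hx : ∀ z, x.supp z = s * y.supp z + t * w.supp z)
    {q : ι → EuclideanSpace ℝ (Fin d)} (hq : ∀ z, ∀ i ∈ argmaxSet q z, x.supp z = inner ℝ (q i) z)
    {i : ι} {e : EuclideanSpace ℝ (Fin d)} (he : e ≠ 0) (hi : argmaxSet q e = {i})
    {z : EuclideanSpace ℝ (Fin d)} (hz : i ∈ argmaxSet q z) :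
    y.supp z = inner ℝ (y.alloc (dir he)) z := by
  set p := y.alloc (dir he) with hp
  set r := w.alloc (dir he) with hr
  have hie : i ∈ argmaxSet q e := hi ▸ rfl
  have hm : ∀ v, inner ℝ (s • p + t • r) v ≤ x.supp v := fun v => by
    rw [hx, inner_add_left, inner_smul_left, inner_smul_left]
    exact add_le_add (mul_le_mul_of_nonneg_left (y.inner_le_supp _ v) hs.le)
      (mul_le_mul_of_nonneg_left (w.inner_le_supp _ v) ht.le)
  have hme : inner ℝ (s • p + t • r) e = x.supp e := by
    rw [hx, inner_add_left, inner_smul_left, inner_smul_left, hp, hr, inner_dir, inner_dir]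
    rfl
  -- The combined point is optimal in the direction `e`, where `q i` is the strict winner. Tilting
  -- `e` towards the difference of the two points bounds its squared length by zero.
  have hmq : s • p + t • r = q i := by
    have hev := eventually_mem_argmaxSet (q := q) (η := s • p + t • r - q i) hie (by
      intro k hk
      rw [hi, Set.mem_singleton_iff] at hk
      rw [hk])
    obtain ⟨ε, hε, hpos⟩ := (hev.and self_mem_nhdsWithin).exists
    have h1 := hm (e + ε • (s • p + t • r - q i))
    rw [hq _ i hε, inner_add_right, inner_add_right, inner_smul_right, inner_smul_right, hme,
      hq _ i hie] at h1
    have h2 : ε * inner ℝ (s • p + t • r - q i) (s • p + t • r - q i) ≤ 0 := by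
      rw [inner_sub_left]
      linarith
    have h3 := (mul_nonpos_iff_pos_imp_nonpos.1 h2).1 (Set.mem_Ioi.1 hpos)
    exact sub_eq_zero.1 (real_inner_self_nonpos.1 h3)
  have h1 : s * inner ℝ p z + t * inner ℝ r z = s * y.supp z + t * w.supp z := by
    rw [← hx, hq z i hz, ← hmq, inner_add_left, inner_smul_left, inner_smul_left]
    rfl
  have h2 : inner ℝ p z ≤ y.supp z := y.inner_le_supp _ z
  have h3 := mul_le_mul_of_nonneg_left (w.inner_le_supp (dir he) z) ht.le
  refine le_antisymm ?_ h2
  by_contra hlt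
  have := mul_lt_mul_of_pos_left (not_le.1 hlt) hs
  linarith

/-- A mechanism that grants a strike and has a polytopal menu without nontrivial Minkowski summands
is an extreme point. -/
theorem toL1_mem_extremePoints_of_rigid [NeZero d] {ι : Type*} [Finite ι] [Nonempty ι]
    {x : Mechanism d} (hstrike : x.GrantsStrike)
    {q : ι → EuclideanSpace ℝ (Fin d)} (hq : ∀ z, ∀ i ∈ argmaxSet q z, x.supp z = inner ℝ (q i) z)
    (hexp : ∀ z, z ≠ 0 → ∀ i ∈ argmaxSet q z, ∃ e, e ≠ 0 ∧ argmaxSet q e = {i})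
    (hrigid : ∀ f : ι → EuclideanSpace ℝ (Fin d), IsSummand q f →
      ∃ (c : ℝ) (t : EuclideanSpace ℝ (Fin d)), ∀ z, z ≠ 0 → ∀ i ∈ argmaxSet q z,
        f i = c • q i + t) :
    x.toL1 ∈ (mechanismClasses d).extremePoints ℝ := by
  refine ⟨⟨x, rfl⟩, ?_⟩
  rintro _ ⟨y, rfl⟩ _ ⟨w, rfl⟩ ⟨s, t, hs, ht, hst, h⟩
  have hx := supp_combination h
  rw [toL1_eq_iff]
  classical
  let f : ι → EuclideanSpace ℝ (Fin d) := fun i =>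
    if hi : ∃ e, e ≠ 0 ∧ argmaxSet q e = {i} then y.alloc (dir hi.choose_spec.1) else 0
  have hf : ∀ z, z ≠ 0 → ∀ i ∈ argmaxSet q z, y.supp z = inner ℝ (f i) z := by
    intro z hz i hi
    have hi' := hexp z hz i hi
    simp only [f, dif_pos hi']
    exact supp_eq_of_mem_argmaxSet hs ht hx hq hi'.choose_spec.1 hi'.choose_spec.2 hi
  obtain ⟨c, b, hcb⟩ := hrigid f fun z i hi j hj => by
    by_cases hz : z = 0
    · rw [hz, inner_zero_right, inner_zero_right]
    · rw [← hf z hz i hi, hf z hz j hj]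
  have hy : ∀ z, y.supp z = c * x.supp z + inner ℝ b z := by
    intro z
    by_cases hz : z = 0
    · simp [hz, supp_zero]
    · obtain ⟨i, hi⟩ := argmaxSet_nonempty q z
      rw [hf z hz i hi, hq z i hi, hcb z hz i hi, inner_add_left, inner_smul_left]
      rfl
  -- Neither `y` nor `w` exceeds the offset and their mixture attains it, so `y` touches every
  -- facet. The coordinate facets give `b = 0`, then the last facet gives `c = 1`.
  have hfacet : ∀ k, (1 - c) * facetOffset k = inner ℝ b (facetNormal k) := by
    intro k
    have h1 := hx (facetNormal k)
    rw [grantsStrike_iff.1 hstrike k] at h1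
    have h2 := y.supp_facetNormal_le k
    have h3 := mul_le_mul_of_nonneg_left (w.supp_facetNormal_le k) ht.le
    have h4 : y.supp (facetNormal k) = facetOffset k := by
      refine le_antisymm h2 ?_
      by_contra hlt
      have := mul_lt_mul_of_pos_left (not_le.1 hlt) hs
      have h5 : facetOffset k = s * facetOffset k + t * facetOffset k := by
        rw [← add_mul, hst, one_mul]
      linarith
    have h5 := hy (facetNormal k)
    rw [h4, grantsStrike_iff.1 hstrike k] at h5
    linarith
  have hb : b = 0 := by
    ext i
    have := hfacet i.castSucc
    simp only [facetOffset, facetNormal, Fin.lastCases_castSucc, inner_neg_right,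
      EuclideanSpace.inner_single_right] at this
    simpa using this.symm
  have hc : c = 1 := by
    have := hfacet (Fin.last d)
    rw [hb, inner_zero_left] at this
    simp only [facetOffset, Fin.lastCases_last] at this
    linarith
  ext z
  rw [hy, hb, hc, inner_zero_left, one_mul, add_zero]

theorem supp_eq_of_argmaxSet {ι : Type*} {x : Mechanism d} {q : ι → EuclideanSpace ℝ (Fin d)}
    (hle : ∀ z i, inner ℝ (q i) z ≤ x.supp z) (hex : ∀ z, ∃ i, x.supp z = inner ℝ (q i) z)
    (z : EuclideanSpace ℝ (Fin d)) (i : ι) (hi : i ∈ argmaxSet q z) :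
    x.supp z = inner ℝ (q i) z := by
  obtain ⟨j, hj⟩ := hex z
  exact le_antisymm (hj ▸ hi j) (hle z i)

/-- Strictly exposed points are affinely independent if there are at most three of them. -/
theorem affineIndependent_of_exposed {E : Type*} [NormedAddCommGroup E] [InnerProductSpace ℝ E]
    {ι : Type*} [Fintype ι] (hcard : Fintype.card ι ≤ 3) {q : ι → E}
    (hexp : ∀ i, ∃ z, ∀ j, j ≠ i → inner ℝ (q j) z < inner ℝ (q i) z) :
    AffineIndependent ℝ q := by
  classical
  rw [affineIndependent_iff_of_fintype]
  intro w hw0 hw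
  rw [Finset.univ.weightedVSub_eq_linear_combination hw0] at hw
  by_contra hne
  push Not at hne
  obtain ⟨i₀, hi₀⟩ := hne
  -- A relation positive at most at `i`, tested on a direction exposing `q i`, becomes a vanishing
  -- sum of nonnegative terms.
  have key : ∀ (u : ι → ℝ) (i : ι), ∑ j, u j = 0 → ∑ j, u j • q j = 0 → (∀ j, j ≠ i → u j ≤ 0) →
      ∀ j, u j = 0 := by
    intro u i hu0 hu hneg
    obtain ⟨z, hz⟩ := hexp i
    have h1 : ∑ j, u j * (inner ℝ (q j) z - inner ℝ (q i) z) = 0 := by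
      have := congrArg (fun v => inner ℝ v z) hu
      simp only [sum_inner, inner_smul_left, inner_zero_left, RCLike.conj_to_real] at this
      simp only [mul_sub, Finset.sum_sub_distrib, ← Finset.sum_mul, hu0, this]
      ring
    have h2 : ∀ j, j ≠ i → u j = 0 := by
      have := (Finset.sum_eq_zero_iff_of_nonneg fun j _ => ?_).1 h1
      · intro j hj
        exact (mul_eq_zero.1 (this j (Finset.mem_univ j))).resolve_right
          (sub_neg.2 (hz j hj)).ne
      · by_cases hj : j = i
        · rw [hj, sub_self, mul_zero]
        · exact mul_nonneg_of_nonpos_of_nonpos (hneg j hj) (sub_neg.2 (hz j hj)).le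
    intro j
    by_cases hj : j = i
    · rw [Finset.sum_eq_single i (fun j _ hj => h2 j hj) (by simp)] at hu0
      rw [hj, hu0]
    · exact h2 j hj
  -- Among at most three coefficients, at most one is positive or at most one is not.
  have hsplit : (∃ i, ∀ j, j ≠ i → w j ≤ 0) ∨ (∃ i, ∀ j, j ≠ i → 0 ≤ w j) := by
    by_cases hpos : (Finset.univ.filter fun j => 0 < w j).card ≤ 1
    · left
      by_cases hex : ∃ i, 0 < w i
      · obtain ⟨i, hi⟩ := hex
        refine ⟨i, fun j hj => not_lt.1 fun hj0 => hj ?_⟩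
        exact Finset.card_le_one.1 hpos j (by simpa using hj0) i (by simpa using hi)
      · push Not at hex
        exact ⟨i₀, fun j _ => hex j⟩
    · right
      have hneg : (Finset.univ.filter fun j => ¬ 0 < w j).card ≤ 1 := by
        have := Finset.card_filter_add_card_filter_not (s := (Finset.univ : Finset ι)) (fun j => 0 < w j)
        rw [Finset.card_univ] at this
        omega
      by_cases hex : ∃ i, ¬ 0 < w i
      · obtain ⟨i, hi⟩ := hex
        refine ⟨i, fun j hj => le_of_lt (not_not.1 fun hj0 => hj ?_)⟩
        exact Finset.card_le_one.1 hneg j (by simpa using hj0) i (by simpa using hi)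
      · push Not at hex
        exact ⟨i₀, fun j _ => (hex j).le⟩
  rcases hsplit with ⟨i, hi⟩ | ⟨i, hi⟩
  · exact hi₀ (key w i hw0 hw hi i₀)
  · have := key (fun j => -w j) i (by simp [hw0]) (by simp [hw])
      (fun j hj => neg_nonpos.2 (hi j hj)) i₀
    exact hi₀ (neg_eq_zero.1 this)

/-- Strike mechanisms with at most three menu items are extreme points. -/
theorem toL1_mem_extremePoints_of_encard_le [NeZero d] {x : Mechanism d}
    (hstrike : x.GrantsStrike) (hcard : x.menu.encard ≤ 3) :
    x.toL1 ∈ (mechanismClasses d).extremePoints ℝ := by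
  have hfin : x.menu.Finite := Set.finite_of_encard_le_coe (k := 3) hcard
  have := hfin.fintype
  obtain ⟨a₀, ha₀, -⟩ := x.exists_mem_menu 0
  have : Nonempty x.menu := ⟨⟨a₀, ha₀⟩⟩
  let q : x.menu → EuclideanSpace ℝ (Fin d) := fun a => a
  have hq := supp_eq_of_argmaxSet (q := q) (fun z i => inner_le_supp_of_mem_menu i.2 z) fun z => by
    obtain ⟨a, ha, h⟩ := x.exists_mem_menu z
    exact ⟨⟨a, ha⟩, h.symm⟩
  have hind : AffineIndependent ℝ q := by
    refine affineIndependent_of_exposed ?_ fun i => ?_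
    · rw [← Nat.card_eq_fintype_card, Nat.card_coe_set_eq]
      rw [← hfin.cast_ncard_eq] at hcard
      exact_mod_cast hcard
    · obtain ⟨θ, hθ, hθi⟩ := exists_uniqueAt_of_finite_menu hfin i.2
      refine ⟨θ, fun j hj => ?_⟩
      have h1 : inner ℝ (q i) (θ : EuclideanSpace ℝ (Fin d)) = x.supp θ := by
        rw [supp_coe, hθi]
      rw [h1]
      refine lt_of_le_of_ne (inner_le_supp_of_mem_menu j.2 _) fun h => hj ?_
      exact Subtype.ext ((hθ _ (fun z => inner_le_supp_of_mem_menu j.2 z) h).trans hθi)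
  have hsub : ∀ z, AffineIndependent ℝ fun i : argmaxSet q z => q i := fun z =>
    hind.comp_embedding (Function.Embedding.subtype _)
  refine toL1_mem_extremePoints_of_rigid hstrike hq
    (fun z _ i hi => exists_argmaxSet_eq_singleton (hsub z) hi) fun f hf => ?_
  obtain ⟨c, hc⟩ := hf.exists_homothety (hsub 0)
  have huniv : ∀ i, i ∈ argmaxSet q 0 := fun i j => by rw [inner_zero_right, inner_zero_right]
  let i₀ : x.menu := ⟨a₀, ha₀⟩
  refine ⟨c, f i₀ - c • q i₀, fun z _ i _ => ?_⟩
  have := hc i (huniv i) i₀ (huniv i₀)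
  rw [smul_sub] at this
  rw [eq_add_of_sub_eq this]
  abel

end Mechanism

/-! ### Perturbing touching families into general position -/

section GeneralPosition

/-- The determinant of a segment of matrices vanishes finitely often, or always. -/
theorem eventually_det_ne_zero {κ : Type*} [Fintype κ] [DecidableEq κ] (A B : Matrix κ κ ℝ)
    {s₀ : ℝ} (h : (A + s₀ • B).det ≠ 0) : ∀ᶠ s : ℝ in 𝓝[>] 0, (A + s • B).det ≠ 0 := by
  set P : Matrix κ κ (Polynomial ℝ) :=
    A.map Polynomial.C + (Polynomial.X : Polynomial ℝ) • B.map Polynomial.C with hP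
  have heval : ∀ s, P.det.eval s = (A + s • B).det := by
    intro s
    rw [← Polynomial.coe_evalRingHom, RingHom.map_det]
    congr 1
    ext i j
    simp [hP]
    ring
  have hne : P.det ≠ 0 := by
    intro h0
    rw [← heval, h0, Polynomial.eval_zero] at h
    exact h rfl
  have hfin : {s : ℝ | P.det.IsRoot s}.Finite := Polynomial.finite_setOfPred_isRoot hne
  -- The parameter 0 may itself be a root. It is exempted, because only small positive parameters
  -- matter.
  have hcl : IsClosed ({s : ℝ | P.det.IsRoot s} \ {0}) := (hfin.subset Set.sdiff_subset).isClosed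
  have hmem : ({s : ℝ | P.det.IsRoot s} \ {0})ᶜ ∈ 𝓝 (0 : ℝ) :=
    hcl.isOpen_compl.mem_nhds (by simp)
  filter_upwards [nhdsWithin_le_nhds hmem, self_mem_nhdsWithin] with s hs hpos h0
  refine hs ⟨?_, (Set.mem_Ioi.1 hpos).ne'⟩
  rw [Set.mem_ofPred_eq, Polynomial.IsRoot.def, heval, h0]

variable {d n : ℕ}

/-- Barycentric coordinates of `d + 1` members of a family of points. -/
def baryMatrix {ι : Type*} (q : ι → EuclideanSpace ℝ (Fin d)) (e : Fin (d + 1) → ι) :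
    Matrix (Fin (d + 1)) (Fin (d + 1)) ℝ :=
  Matrix.of fun i j => prob (q (e i)) j

/-- Families of lotteries whose first `d + 1` members lie on the `d + 1` facets of the simplex. -/
def IsTouching (q : Fin (d + 1) ⊕ Fin n → EuclideanSpace ℝ (Fin d)) : Prop :=
  (∀ i, q i ∈ lotteries d) ∧ ∀ k, prob (q (Sum.inl k)) k = 0

theorem IsTouching.combination {q r : Fin (d + 1) ⊕ Fin n → EuclideanSpace ℝ (Fin d)}
    (hq : IsTouching q) (hr : IsTouching r) {s : ℝ} (h0 : 0 ≤ s) (h1 : s ≤ 1) :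
    IsTouching fun i => (1 - s) • q i + s • r i := by
  have hst : 1 - s + s = 1 := by ring
  refine ⟨fun i => ?_, fun k => ?_⟩
  · rw [mem_lotteries_iff]
    intro k
    rw [prob_combination _ _ hst]
    exact add_nonneg (mul_nonneg (by linarith) (mem_lotteries_iff.1 (hq.1 i) k))
      (mul_nonneg h0 (mem_lotteries_iff.1 (hr.1 i) k))
  · rw [prob_combination _ _ hst, hq.2, hr.2, mul_zero, mul_zero, add_zero]

/-- Sending each position of `Sum.inl k` to the cyclic successor of `k` is injective and avoids `k`.
Any extension to a permutation will do. -/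
theorem exists_perm_avoiding [NeZero d] {e : Fin (d + 1) → Fin (d + 1) ⊕ Fin n}
    (he : Function.Injective e) :
    ∃ τ : Equiv.Perm (Fin (d + 1)), ∀ i k, e i = Sum.inl k → τ i ≠ k := by
  classical
  let g : {i // ∃ k, e i = Sum.inl k} → Fin (d + 1) := fun i => i.2.choose + 1
  have hg : Function.Injective g := by
    intro i j hij
    have h1 : i.2.choose = j.2.choose := add_right_cancel hij
    refine Subtype.ext (he ?_)
    rw [i.2.choose_spec, j.2.choose_spec, h1]
  let φ : {i // ∃ k, e i = Sum.inl k} ≃ {j // j ∈ Set.range g} := Equiv.ofInjective g hg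
  refine ⟨φ.extendSubtype, fun i k hik => ?_⟩
  rw [Equiv.extendSubtype_apply_of_mem φ i ⟨k, hik⟩]
  change (⟨i, k, hik⟩ : {i // ∃ k, e i = Sum.inl k}).2.choose + 1 ≠ k
  have hk : (⟨i, k, hik⟩ : {i // ∃ k, e i = Sum.inl k}).2.choose = k := by
    have := (⟨i, k, hik⟩ : {i // ∃ k, e i = Sum.inl k}).2.choose_spec
    exact Sum.inl_injective (this.symm.trans hik)
  rw [hk]
  have : Nontrivial (Fin (d + 1)) := Fin.nontrivial_iff_two_le.2 (by have := NeZero.ne d; omega)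
  simp

/-- Put every point at a vertex, the selected ones at distinct vertices. The barycentric matrix is
then a permutation matrix, and avoiding `k` keeps the contact with facet `k`. -/
theorem exists_isTouching_det_ne_zero [NeZero d] {e : Fin (d + 1) → Fin (d + 1) ⊕ Fin n}
    (he : Function.Injective e) :
    ∃ r : Fin (d + 1) ⊕ Fin n → EuclideanSpace ℝ (Fin d), IsTouching r ∧
      (baryMatrix r e).det ≠ 0 := by
  classical
  obtain ⟨τ, hτ⟩ := exists_perm_avoiding he
  have : Nontrivial (Fin (d + 1)) := Fin.nontrivial_iff_two_le.2 (by have := NeZero.ne d; omega)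
  let σ : Fin (d + 1) ⊕ Fin n → Fin (d + 1) := fun a =>
    if h : ∃ i, e i = a then τ h.choose else Sum.elim (fun k => k + 1) (fun _ => 0) a
  have hσe : ∀ i, σ (e i) = τ i := fun i => by
    have h : ∃ j, e j = e i := ⟨i, rfl⟩
    simp only [σ, dif_pos h]
    rw [he h.choose_spec]
  have hσ : ∀ k, σ (Sum.inl k) ≠ k := by
    intro k
    by_cases h : ∃ i, e i = Sum.inl k
    · simp only [σ, dif_pos h]
      exact hτ _ _ h.choose_spec
    · simp only [σ, dif_neg h, Sum.elim_inl]
      simp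
  refine ⟨fun a => vertex (σ a), ⟨fun a => vertex_mem_lotteries _, fun k => ?_⟩, ?_⟩
  · rw [prob_vertex, if_neg (hσ k).symm]
  · have hM : baryMatrix (fun a => vertex (σ a)) e = τ.permMatrix ℝ := by
      ext i j
      simp [baryMatrix, prob_vertex, hσe, Equiv.Perm.permMatrix, PEquiv.toMatrix_apply, eq_comm]
    rw [hM, Matrix.det_permutation]
    rcases Int.units_eq_one_or (Equiv.Perm.sign τ) with h | h <;> simp [h]

theorem baryMatrix_combination {ι : Type*} (q r : ι → EuclideanSpace ℝ (Fin d))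
    (e : Fin (d + 1) → ι) (s : ℝ) :
    baryMatrix (fun i => (1 - s) • q i + s • r i) e =
      baryMatrix q e + s • (baryMatrix r e - baryMatrix q e) := by
  ext i j
  simp only [baryMatrix, Matrix.of_apply, Matrix.add_apply, Matrix.smul_apply, Matrix.sub_apply,
    smul_eq_mul]
  rw [prob_combination _ _ (by ring)]
  ring

/-- A touching family can be perturbed into general position. -/
theorem exists_near_isTouching [NeZero d]
    (s : Finset (Fin (d + 1) ↪ Fin (d + 1) ⊕ Fin n)) :
    ∀ {q : Fin (d + 1) ⊕ Fin n → EuclideanSpace ℝ (Fin d)}, IsTouching q → ∀ {ε : ℝ}, 0 < ε →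
      ∃ r : Fin (d + 1) ⊕ Fin n → EuclideanSpace ℝ (Fin d), IsTouching r ∧
        (∀ i, ‖r i - q i‖ < ε) ∧ ∀ e ∈ s, (baryMatrix r e).det ≠ 0 := by
  classical
  induction s using Finset.induction_on with
  | empty =>
    intro q hq ε hε
    exact ⟨q, hq, fun i => by simpa using hε, by simp⟩
  | insert e s _ ih =>
    intro q hq ε hε
    obtain ⟨q₁, hq₁, hnear, hdet⟩ := ih hq (half_pos hε)
    obtain ⟨r, hr, hrdet⟩ := exists_isTouching_det_ne_zero e.injective
    have h1 : ∀ᶠ t : ℝ in 𝓝[>] 0, ∀ e' ∈ insert e s,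
        (baryMatrix (fun i => (1 - t) • q₁ i + t • r i) e').det ≠ 0 := by
      rw [Filter.eventually_all_finset]
      intro e' he'
      simp only [baryMatrix_combination]
      -- On the segment from `q₁` to `r`, the new determinant is nonzero at parameter 1 and the
      -- earlier ones at parameter 0.
      rcases Finset.mem_insert.1 he' with rfl | he'
      · exact eventually_det_ne_zero _ _ (s₀ := 1) (by simpa using hrdet)
      · exact eventually_det_ne_zero _ _ (s₀ := 0) (by simpa using hdet e' he')
    have h2 : ∀ᶠ t : ℝ in 𝓝[>] 0, ∀ i, ‖((1 - t) • q₁ i + t • r i) - q₁ i‖ < ε / 2 := by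
      refine Filter.eventually_all.2 fun i => ?_
      have hc : Continuous fun t : ℝ => ‖((1 - t) • q₁ i + t • r i) - q₁ i‖ := by fun_prop
      exact ((hc.tendsto' 0 0 (by simp)).eventually (gt_mem_nhds (half_pos hε))).filter_mono
        nhdsWithin_le_nhds
    have h3 : ∀ᶠ t : ℝ in 𝓝[>] 0, t ≤ 1 :=
      ((ge_mem_nhds zero_lt_one) : ∀ᶠ t : ℝ in 𝓝 0, t ≤ 1).filter_mono nhdsWithin_le_nhds
    obtain ⟨t, ht1, ht2, ht3, hpos⟩ := (h1.and (h2.and (h3.and self_mem_nhdsWithin))).exists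
    refine ⟨_, hq₁.combination hr (Set.mem_Ioi.1 hpos).le ht3, fun i => ?_, ht1⟩
    have := norm_add_le (((1 - t) • q₁ i + t • r i) - q₁ i) (q₁ i - q i)
    rw [sub_add_sub_cancel] at this
    linarith [ht2 i, hnear i]

/-- An affine dependence is a left null vector of the barycentric matrix. -/
theorem affineIndependent_of_det_ne_zero {ι : Type*} {q : ι → EuclideanSpace ℝ (Fin d)}
    {e : Fin (d + 1) → ι} (h : (baryMatrix q e).det ≠ 0) :
    AffineIndependent ℝ fun i => q (e i) := by
  rw [affineIndependent_iff_of_fintype]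
  intro w hw0 hw
  rw [Finset.univ.weightedVSub_eq_linear_combination hw0] at hw
  have hv : Matrix.vecMul w (baryMatrix q e) = 0 := by
    ext j
    have h1 := congrArg (fun v => inner ℝ v (facetNormal j)) hw
    simp only [sum_inner, inner_smul_left, RCLike.conj_to_real, inner_zero_left] at h1
    simp only [Matrix.vecMul, dotProduct, baryMatrix, Matrix.of_apply, prob_eq, mul_sub,
      Finset.sum_sub_distrib, ← Finset.sum_mul, hw0, h1, Pi.zero_apply]
    ring
  exact fun i => congrFun (Matrix.eq_zero_of_vecMul_eq_zero h hv) i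

theorem inner_eq_sum_prob (a z : EuclideanSpace ℝ (Fin d)) (c : ℝ) :
    ∑ k, prob a k * Fin.lastCases (motive := fun _ => ℝ) (-c) (fun i => z i - c) k =
      inner ℝ a z - c := by
  have h := sum_prob a
  rw [Fin.sum_univ_castSucc] at h
  rw [Fin.sum_univ_castSucc]
  have h1 : ∀ i : Fin d, prob a i.castSucc = a i := fun i => by simp [prob]
  simp only [Fin.lastCases_last, Fin.lastCases_castSucc, mul_sub, Finset.sum_sub_distrib,
    ← Finset.sum_mul]
  rw [PiLp.inner_apply]
  simp only [h1] at h ⊢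
  have h2 : ∑ i, a i * z i = ∑ i, inner ℝ (a i) (z i) :=
    Finset.sum_congr rfl fun i _ => by simp [mul_comm]
  rw [← h2]
  linear_combination (-c) * h

/-- The values of the affine function `⟨·, z⟩ - c` at the vertices of the simplex form a right null
vector of the barycentric matrix. -/
theorem eq_zero_of_det_ne_zero {ι : Type*} {q : ι → EuclideanSpace ℝ (Fin d)}
    {e : Fin (d + 1) → ι} (h : (baryMatrix q e).det ≠ 0) {z : EuclideanSpace ℝ (Fin d)} {c : ℝ}
    (hz : ∀ i, inner ℝ (q (e i)) z = c) : z = 0 := by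
  have hv : Matrix.mulVec (baryMatrix q e)
      (fun k => Fin.lastCases (motive := fun _ => ℝ) (-c) (fun i => z i - c) k) = 0 := by
    ext i
    simp only [Matrix.mulVec, dotProduct, baryMatrix, Matrix.of_apply, Pi.zero_apply]
    rw [inner_eq_sum_prob, hz, sub_self]
  have h0 := Matrix.eq_zero_of_mulVec_eq_zero h hv
  have hc : c = 0 := by
    have := congrFun h0 (Fin.last d)
    simpa using this
  ext i
  have := congrFun h0 i.castSucc
  simpa [hc] using this

/-- Families in general position only have simplices as proper faces. -/
theorem affineIndependent_argmaxSet {ι : Type*} [Fintype ι] (hcard : d + 1 ≤ Fintype.card ι)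
    {q : ι → EuclideanSpace ℝ (Fin d)}
    (hq : ∀ e : Fin (d + 1) ↪ ι, (baryMatrix q e).det ≠ 0)
    {z : EuclideanSpace ℝ (Fin d)} (hz : z ≠ 0) :
    AffineIndependent ℝ fun i : argmaxSet q z => q i := by
  classical
  set I : Finset ι := (argmaxSet q z).toFinite.toFinset with hI
  have hmem : ∀ i, i ∈ I ↔ i ∈ argmaxSet q z := fun i => by simp [hI]
  -- Otherwise `d + 1` members would share one hyperplane with normal `z ≠ 0`.
  have hle : I.card ≤ d + 1 := by
    by_contra hlt
    obtain ⟨J, hJI, hJ⟩ := Finset.exists_subset_card_eq (show d + 1 ≤ I.card by omega)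
    let e : Fin (d + 1) ↪ ι :=
      (J.equivFinOfCardEq hJ).symm.toEmbedding.trans (Function.Embedding.subtype _)
    have he : ∀ i, e i ∈ argmaxSet q z := fun i =>
      (hmem _).1 (hJI ((J.equivFinOfCardEq hJ).symm i).2)
    exact hz (eq_zero_of_det_ne_zero (hq e) fun i => inner_eq_of_mem_argmaxSet (he i) (he 0))
  obtain ⟨J, hIJ, -, hJ⟩ := Finset.exists_subsuperset_card_eq (Finset.subset_univ I) hle
    (by rwa [Finset.card_univ])
  let e : Fin (d + 1) ↪ ι :=
    (J.equivFinOfCardEq hJ).symm.toEmbedding.trans (Function.Embedding.subtype _)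
  have hind := affineIndependent_of_det_ne_zero (hq e)
  let g : argmaxSet q z ↪ Fin (d + 1) :=
    ⟨fun i => J.equivFinOfCardEq hJ ⟨i, hIJ ((hmem _).2 i.2)⟩, fun i j hij => by
      have := (J.equivFinOfCardEq hJ).injective hij
      exact Subtype.ext (Subtype.mk.inj this)⟩
  have := hind.comp_embedding g
  have heq : ((fun i => q (e i)) ∘ g) = fun i : argmaxSet q z => q i := by
    ext1 i
    change q ((J.equivFinOfCardEq hJ).symm (J.equivFinOfCardEq hJ ⟨i, _⟩) : J) = q i
    rw [Equiv.symm_apply_apply]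
  rwa [heq] at this

theorem interior_convexHull_nonempty_of_det_ne_zero {ι : Type*}
    {q : ι → EuclideanSpace ℝ (Fin d)} {e : Fin (d + 1) → ι} (h : (baryMatrix q e).det ≠ 0) :
    (interior (convexHull ℝ (Set.range q))).Nonempty := by
  rw [interior_convexHull_nonempty_iff_affineSpan_eq_top, eq_top_iff]
  have h1 := (affineIndependent_of_det_ne_zero h).affineSpan_eq_top_iff_card_eq_finrank_add_one.2
    (by simp)
  rw [← h1]
  refine affineSpan_mono ℝ ?_
  rintro _ ⟨i, rfl⟩
  exact ⟨e i, rfl⟩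

end GeneralPosition

/-! ### Convergence in `L¹` and density -/

namespace Mechanism

variable {d : ℕ}

/-- If asymptotically the mechanisms `y n` offer no more than `x` and are as good as `x` for the
type `θ`, then the allocations of `θ` converge wherever that of `x` is uniquely optimal. -/
theorem tendsto_alloc {x : Mechanism d} {y : ℕ → Mechanism d} {θ : TypeSpace d}
    (hθ : x.UniqueAt θ)
    (hle : ∀ z, ∀ δ > 0, ∀ᶠ n in Filter.atTop, (y n).supp z ≤ x.supp z + δ)
    (hge : ∀ δ > 0, ∀ᶠ n in Filter.atTop, x.supp θ - δ ≤ (y n).supp θ) :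
    Filter.Tendsto (fun n => (y n).alloc θ) Filter.atTop (𝓝 (x.alloc θ)) := by
  refine Filter.tendsto_of_subseq_tendsto fun ns hns => ?_
  obtain ⟨p, -, φ, hφ, hp⟩ := isCompact_lotteries.tendsto_subseq
    fun n => (y (ns n)).alloc_mem θ
  have hsub : Filter.Tendsto (fun n => ns (φ n)) Filter.atTop Filter.atTop :=
    hns.comp hφ.tendsto_atTop
  refine ⟨φ, ?_⟩
  have hlim : ∀ z, Filter.Tendsto (fun n => inner ℝ ((y (ns (φ n))).alloc θ) z) Filter.atTop
      (𝓝 (inner ℝ p z)) := fun z => hp.inner tendsto_const_nhds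
  have h1 : ∀ z, inner ℝ p z ≤ x.supp z := by
    refine fun z => le_of_forall_pos_le_add fun δ hδ => ?_
    refine le_of_tendsto (hlim z) ?_
    filter_upwards [hsub.eventually (hle z δ hδ)] with n hn
    exact ((y _).inner_le_supp θ z).trans hn
  have h2 : inner ℝ p (θ : EuclideanSpace ℝ (Fin d)) = x.supp θ := by
    refine le_antisymm (h1 _) (le_of_forall_pos_sub_le fun δ hδ => ?_)
    refine ge_of_tendsto (hlim θ) ?_
    filter_upwards [hsub.eventually (hge δ hδ)] with n hn
    rwa [← supp_coe]
  -- Every subsequential limit lies in the body of `x` and is optimal for `θ`, so uniqueness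
  -- identifies it.
  rw [← hθ p h1 h2]
  exact hp

theorem tendsto_toL1 {x : Mechanism d} {y : ℕ → Mechanism d}
    (h : ∀ᵐ θ ∂sphericalMeasure d,
      Filter.Tendsto (fun n => (y n).alloc θ) Filter.atTop (𝓝 (x.alloc θ))) :
    Filter.Tendsto (fun n => (y n).toL1) Filter.atTop (𝓝 x.toL1) := by
  unfold toL1
  rw [Lp.tendsto_Lp_iff_tendsto_eLpNorm'' _ (fun n => (y n).memLp_alloc) _ x.memLp_alloc]
  simp only [eLpNorm_one_eq_lintegral_enorm]
  have h0 : ∫⁻ _ : TypeSpace d, (0 : ENNReal) ∂sphericalMeasure d = 0 := by simp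
  rw [← h0]
  refine tendsto_lintegral_of_dominated_convergence (fun _ => 2) (fun n => ?_) (fun n => ?_) ?_ ?_
  · exact ((y n).measurable_alloc.sub x.measurable_alloc).enorm
  · refine Filter.Eventually.of_forall fun θ => ?_
    have h1 : ‖(y n).alloc θ - x.alloc θ‖ ≤ 2 := by
      have := norm_sub_le ((y n).alloc θ) (x.alloc θ)
      linarith [(y n).norm_alloc_le θ, x.norm_alloc_le θ]
    simp only [Pi.sub_apply]
    rw [← ofReal_norm]
    exact (ENNReal.ofReal_le_ofReal h1).trans_eq (by simp)
  · rw [lintegral_const]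
    exact ENNReal.mul_ne_top (by simp) (measure_ne_top _ _)
  · filter_upwards [h] with θ hθ
    have h1 := (tendsto_iff_norm_sub_tendsto_zero.1 hθ)
    have h2 := ENNReal.tendsto_ofReal h1
    rw [ENNReal.ofReal_zero] at h2
    refine h2.congr fun n => ?_
    rw [ofReal_norm]
    rfl

end Mechanism

open Mechanism

/-- Touching families in general position are menus of extreme points that grant a strike. -/
theorem exists_mechanism_of_generalPosition {d n : ℕ} (hd : 3 ≤ d)
    {r : Fin (d + 1) ⊕ Fin n → EuclideanSpace ℝ (Fin d)} (hr : IsTouching r)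
    (hdet : ∀ e : Fin (d + 1) ↪ Fin (d + 1) ⊕ Fin n, (baryMatrix r e).det ≠ 0) :
    ∃ y : Mechanism d, (∀ z i, inner ℝ (r i) z ≤ y.supp z) ∧
      (∀ z, ∃ i, y.supp z = inner ℝ (r i) z) ∧ y.GrantsStrike ∧
      y.toL1 ∈ (mechanismClasses d).extremePoints ℝ := by
  have : NeZero d := ⟨by omega⟩
  obtain ⟨y, hy, hy'⟩ := exists_of_finite r hr.1
  have hle := inner_le_supp_of_finite hy'
  have hex := exists_supp_eq_of_finite hy
  have hstrike : y.GrantsStrike := by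
    rw [grantsStrike_iff]
    intro k
    refine le_antisymm (y.supp_facetNormal_le k) ?_
    have h1 := hr.2 k
    rw [prob_eq] at h1
    linarith [hle (facetNormal k) (Sum.inl k)]
  have hind : ∀ z, z ≠ 0 → AffineIndependent ℝ fun i : argmaxSet r z => r i := fun z hz =>
    affineIndependent_argmaxSet (by simp) hdet hz
  have hfr : Fact (Module.finrank ℝ (EuclideanSpace ℝ (Fin d)) = d - 1 + 1) :=
    ⟨by rw [finrank_euclideanSpace_fin]; omega⟩
  refine ⟨y, hle, hex, hstrike, toL1_mem_extremePoints_of_rigid hstrike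
    (supp_eq_of_argmaxSet hle hex)
    (fun z hz i hi => exists_argmaxSet_eq_singleton (hind z hz) hi) fun f hf => ?_⟩
  -- At least four alternatives enter here: `d ≥ 3` makes the boundary of dimension `d - 1 ≥ 2`.
  exact hf.exists_global_homothety (n := d - 1) (by omega) hind
    (interior_convexHull_nonempty_of_det_ne_zero (hdet Function.Embedding.inl))

/-- With at least four alternatives, extreme points that grant a strike are dense among the
mechanisms that grant a strike. -/
theorem strikeClasses_subset_closure {d : ℕ} (hd : 3 ≤ d) :
    strikeClasses d ⊆
      closure ((mechanismClasses d).extremePoints ℝ ∩ strikeClasses d) := by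
  have : NeZero d := ⟨by omega⟩
  rintro _ ⟨x, hx, rfl⟩
  let φ : ℕ → TypeSpace d := TopologicalSpace.denseSeq (TypeSpace d)
  -- The facet-normal types supply the contacts. The first `n` members of a dense sequence of types
  -- make the menus exhaust `x`.
  let q : (n : ℕ) → Fin (d + 1) ⊕ Fin n → EuclideanSpace ℝ (Fin d) := fun n =>
    Sum.elim (fun k => x.alloc (dir (facetNormal_ne_zero k))) (fun i => x.alloc (φ i))
  have hqx : ∀ n i z, inner ℝ (q n i) z ≤ x.supp z := by
    rintro n (k | i) z
    · exact x.inner_le_supp _ z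
    · exact x.inner_le_supp _ z
  have hq : ∀ n, IsTouching (q n) := by
    refine fun n => ⟨?_, fun k => ?_⟩
    · rintro (k | i)
      · exact x.alloc_mem _
      · exact x.alloc_mem _
    · change prob (x.alloc (dir (facetNormal_ne_zero k))) k = 0
      rw [prob_eq, inner_dir, grantsStrike_iff.1 hx, sub_self]
  have hr := fun n : ℕ => exists_near_isTouching Finset.univ (hq n) (ε := 1 / ((n : ℝ) + 1))
    Nat.one_div_pos_of_nat
  choose r hrt hrq hrdet using hr
  choose y hyle hyex hys hye using fun n => exists_mechanism_of_generalPosition hd (hrt n)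
    fun e => hrdet n e (Finset.mem_univ e)
  have hdiff : ∀ n i z, |inner ℝ (r n i) z - inner ℝ (q n i) z| ≤ 1 / ((n : ℝ) + 1) * ‖z‖ := by
    intro n i z
    rw [← inner_sub_left]
    exact (abs_real_inner_le_norm _ _).trans
      (mul_le_mul_of_nonneg_right (hrq n i).le (norm_nonneg z))
  have hsmall : ∀ (z : EuclideanSpace ℝ (Fin d)), ∀ δ > 0, ∀ᶠ n : ℕ in Filter.atTop,
      1 / ((n : ℝ) + 1) * ‖z‖ < δ := by
    intro z δ hδ
    have h1 := (tendsto_one_div_add_atTop_nhds_zero_nat (𝕜 := ℝ)).mul_const ‖z‖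
    rw [zero_mul] at h1
    exact h1.eventually (gt_mem_nhds hδ)
  refine mem_closure_of_tendsto (tendsto_toL1 (x := x) (y := y) ?_)
    (Filter.Eventually.of_forall fun n => ⟨hye n, y n, hys n, rfl⟩)
  filter_upwards [x.ae_uniqueAt] with θ hθ
  refine tendsto_alloc hθ (fun z δ hδ => ?_) fun δ hδ => ?_
  · filter_upwards [hsmall z δ hδ] with n hn
    obtain ⟨i, hi⟩ := hyex n z
    rw [hi]
    have := (abs_le.1 (hdiff n i z)).2
    linarith [hqx n i z]
  -- Three errors of at most `δ / 4`: perturbing the menu, moving the type in the inner product, and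
  -- moving it in `supp`.
  · have hball : (Metric.ball θ (δ / 4)).Nonempty := ⟨θ, Metric.mem_ball_self (by linarith)⟩
    obtain ⟨m, hm⟩ := (TopologicalSpace.denseRange_denseSeq (TypeSpace d)).exists_mem_open
      Metric.isOpen_ball hball
    have hm' : dist (φ m : EuclideanSpace ℝ (Fin d)) θ < δ / 4 := hm
    filter_upwards [hsmall (θ : EuclideanSpace ℝ (Fin d)) (δ / 4) (by linarith),
      Filter.eventually_gt_atTop m] with n hn hmn
    have h1 := hyle n (θ : EuclideanSpace ℝ (Fin d)) (Sum.inr ⟨m, hmn⟩)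
    have h2 := (abs_le.1 (hdiff n (Sum.inr ⟨m, hmn⟩) (θ : EuclideanSpace ℝ (Fin d)))).1
    have h3 : inner ℝ (q n (Sum.inr ⟨m, hmn⟩)) (φ m : EuclideanSpace ℝ (Fin d)) =
        x.supp (φ m) := (x.supp_coe (φ m)).symm
    have h4 : inner ℝ (q n (Sum.inr ⟨m, hmn⟩))
        ((φ m : EuclideanSpace ℝ (Fin d)) - θ) ≤ δ / 4 := by
      refine (real_inner_le_norm _ _).trans ?_
      rw [← dist_eq_norm]
      have h5 : ‖q n (Sum.inr ⟨m, hmn⟩)‖ ≤ 1 := x.norm_alloc_le (φ m)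
      nlinarith [dist_nonneg (x := (φ m : EuclideanSpace ℝ (Fin d))) (y := θ)]
    rw [inner_sub_right] at h4
    have h6 := x.supp_lipschitz.dist_le_mul (θ : EuclideanSpace ℝ (Fin d)) (φ m)
    rw [dist_comm, Real.dist_eq, NNReal.coe_one, one_mul, dist_comm] at h6
    have h7 := (abs_le.1 h6).1
    linarith

/-! ### Perturbations of extreme points -/

namespace Mechanism

variable {d : ℕ}

/-- Extreme points admit no perturbation in opposite directions that changes payoffs. -/
theorem inner_eq_zero_of_mem_extremePoints [NeZero d] {x : Mechanism d}
    (hx : x.toL1 ∈ (mechanismClasses d).extremePoints ℝ)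
    {y : TypeSpace d → EuclideanSpace ℝ (Fin d)} (hy : Measurable y)
    (hadd : ∀ θ, x.alloc θ + y θ ∈ lotteries d) (hsub : ∀ θ, x.alloc θ - y θ ∈ lotteries d)
    (hic : ∀ θ θ' : TypeSpace d, |inner ℝ (y θ - y θ') (θ : EuclideanSpace ℝ (Fin d))| ≤
      inner ℝ (x.alloc θ - x.alloc θ') (θ : EuclideanSpace ℝ (Fin d))) (θ : TypeSpace d) :
    inner ℝ (y θ) (θ : EuclideanSpace ℝ (Fin d)) = 0 := by
  let x₁ : Mechanism d := ⟨fun θ => x.alloc θ + y θ, x.measurable_alloc.add hy, hadd, fun θ θ' => by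
    have h := (abs_le.1 (hic θ θ')).1
    rw [inner_sub_left, inner_sub_left] at h
    rw [inner_add_left, inner_add_left]
    linarith⟩
  let x₂ : Mechanism d := ⟨fun θ => x.alloc θ - y θ, x.measurable_alloc.sub hy, hsub, fun θ θ' => by
    have h := (abs_le.1 (hic θ θ')).2
    rw [inner_sub_left, inner_sub_left] at h
    rw [inner_sub_left, inner_sub_left]
    linarith⟩
  have hcomb : (2⁻¹ : ℝ) • x₁.toL1 + (2⁻¹ : ℝ) • x₂.toL1 = x.toL1 := by
    refine toL1_combination fun θ => ?_
    change x.alloc θ = (2⁻¹ : ℝ) • (x.alloc θ + y θ) + (2⁻¹ : ℝ) • (x.alloc θ - y θ)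
    module
  have h := hx.2 ⟨x₁, rfl⟩ ⟨x₂, rfl⟩
    ⟨2⁻¹, 2⁻¹, by norm_num, by norm_num, by norm_num, hcomb⟩
  rw [toL1_eq_iff] at h
  have h1 := congrFun h (θ : EuclideanSpace ℝ (Fin d))
  rw [supp_coe, supp_coe] at h1
  change inner ℝ (x.alloc θ + y θ) _ = _ at h1
  rw [inner_add_left] at h1
  linarith

/-- An extreme point whose menu misses the facet of alternative `k` dictates alternative `k`. -/
theorem supp_eq_of_mem_extremePoints [NeZero d] {x : Mechanism d}
    (hx : x.toL1 ∈ (mechanismClasses d).extremePoints ℝ) {k : Fin (d + 1)}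
    (hk : x.supp (facetNormal k) ≠ facetOffset k) (z : EuclideanSpace ℝ (Fin d)) :
    x.supp z = inner ℝ (vertex k) z := by
  set δ := facetOffset k - x.supp (facetNormal k) with hδ
  have hδ0 : 0 < δ := sub_pos.2 (lt_of_le_of_ne (x.supp_facetNormal_le k) hk)
  have hprob : ∀ θ, δ ≤ prob (x.alloc θ) k := fun θ => by
    rw [prob_eq, hδ]
    linarith [x.inner_le_supp θ (facetNormal k)]
  have hδ1 : δ ≤ 1 := by
    obtain ⟨θ⟩ := (inferInstance : Nonempty (TypeSpace d))
    refine (hprob θ).trans ?_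
    rw [← sum_prob (x.alloc θ)]
    exact Finset.single_le_sum (fun j _ => mem_lotteries_iff.1 (x.alloc_mem θ) j)
      (Finset.mem_univ k)
  -- Scaling about vertex `k` multiplies the other probabilities by `s ≥ 0`, and that of `k` has
  -- slack `δ`.
  have hmem : ∀ θ, ∀ s : ℝ, |s - 1| ≤ δ →
      s • x.alloc θ + (1 - s) • vertex k ∈ lotteries d := by
    intro θ s hs
    obtain ⟨hs1, hs2⟩ := abs_le.1 hs
    rw [mem_lotteries_iff]
    intro j
    rw [prob_combination _ _ (by ring), prob_vertex]
    have h0 := mem_lotteries_iff.1 (x.alloc_mem θ) j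
    split_ifs with hj
    · rw [hj] at h0 ⊢
      nlinarith [hprob θ]
    · rw [mul_zero, add_zero]
      exact mul_nonneg (by linarith) h0
  have hy : ∀ θ : TypeSpace d, inner ℝ (δ • (x.alloc θ - vertex k))
      (θ : EuclideanSpace ℝ (Fin d)) = 0 := by
    refine inner_eq_zero_of_mem_extremePoints hx
      (y := fun θ => δ • (x.alloc θ - vertex k))
      ((x.measurable_alloc.sub_const _).const_smul δ) (fun θ => ?_) (fun θ => ?_) fun θ θ' => ?_
    · convert hmem θ (1 + δ) (by rw [add_sub_cancel_left, abs_of_pos hδ0]) using 1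
      module
    · convert hmem θ (1 - δ) (by rw [sub_sub_cancel_left, abs_neg, abs_of_pos hδ0]) using 1
      module
    · have h1 : δ • (x.alloc θ - vertex k) - δ • (x.alloc θ' - vertex k) =
          δ • (x.alloc θ - x.alloc θ') := by module
      have h2 : 0 ≤ inner ℝ (x.alloc θ - x.alloc θ') (θ : EuclideanSpace ℝ (Fin d)) := by
        rw [inner_sub_left]
        exact sub_nonneg.2 (x.incentive_compatible θ θ')
      rw [h1, inner_smul_left, RCLike.conj_to_real, abs_of_nonneg (mul_nonneg hδ0.le h2)]
      nlinarith
  have hs : x.supp = fun z => inner ℝ (vertex k) z := by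
    refine supp_eq_of_ae (by fun_prop) (fun c _ z => by rw [inner_smul_right])
      (Filter.Eventually.of_forall fun θ => ?_)
    have := hy θ
    rw [inner_smul_left, RCLike.conj_to_real, inner_sub_left] at this
    rw [supp_coe]
    exact sub_eq_zero.1 ((mul_eq_zero.1 this).resolve_left hδ0.ne')
  exact congrFun hs z

/-- The variation of `y` between two types is bounded by `C` times that of the mechanism. -/
def Dominates (x : Mechanism d) (y : TypeSpace d → EuclideanSpace ℝ (Fin d)) (C : ℝ)
    (θ θ' : TypeSpace d) : Prop :=
  |inner ℝ (y θ - y θ') (θ : EuclideanSpace ℝ (Fin d))| ≤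
    C * inner ℝ (x.alloc θ - x.alloc θ') (θ : EuclideanSpace ℝ (Fin d))

/-- Since `P α = S b - Q β`, the change from `α` to `β` seen by `α`, times `P`, is `P` times the
change from `α` to `b` seen by `α`, plus `S` times that from `b` to `β` seen by `b`, plus `Q` times
that from `β` to `b` seen by `β`. All weights are nonnegative, so the three bounds add up. -/
theorem Dominates.trans {x : Mechanism d} {y : TypeSpace d → EuclideanSpace ℝ (Fin d)} {C : ℝ}
    {α b β : TypeSpace d} {P Q S : ℝ} (hP : 0 < P) (hQ : 0 ≤ Q) (hS : 0 ≤ S)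
    (h : S • (b : EuclideanSpace ℝ (Fin d)) =
      P • (α : EuclideanSpace ℝ (Fin d)) + Q • (β : EuclideanSpace ℝ (Fin d)))
    (h1 : x.Dominates y C α b) (h2 : x.Dominates y C b β) (h3 : x.Dominates y C β b) :
    x.Dominates y C α β := by
  have key : ∀ v : EuclideanSpace ℝ (Fin d),
      P * inner ℝ v (α : EuclideanSpace ℝ (Fin d)) =
        S * inner ℝ v (b : EuclideanSpace ℝ (Fin d)) -
          Q * inner ℝ v (β : EuclideanSpace ℝ (Fin d)) := by
    intro v
    have := congrArg (fun w => inner ℝ v w) h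
    simp only [inner_add_right, inner_smul_right] at this
    linarith
  unfold Dominates at *
  simp only [inner_sub_left] at *
  have kx := key (x.alloc b)
  have kx' := key (x.alloc β)
  have ky := key (y b)
  have ky' := key (y β)
  obtain ⟨a1, a2⟩ := abs_le.1 h1
  obtain ⟨b1, b2⟩ := abs_le.1 h2
  obtain ⟨c1, c2⟩ := abs_le.1 h3
  have b1' := mul_le_mul_of_nonneg_left b1 hS
  have b2' := mul_le_mul_of_nonneg_left b2 hS
  have c1' := mul_le_mul_of_nonneg_left c1 hQ
  have c2' := mul_le_mul_of_nonneg_left c2 hQ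
  have a1' := mul_le_mul_of_nonneg_left a1 hP.le
  have a2' := mul_le_mul_of_nonneg_left a2 hP.le
  rw [abs_le]
  constructor <;> refine le_of_mul_le_mul_left ?_ hP
  · linear_combination a1' + b1' + c1' - ky + ky' - C * kx + C * kx'
  · linear_combination a2' + b2' + c2' + ky - ky' - C * kx + C * kx'

end Mechanism

/-! ### Angles on the circle of types -/

section Circle

/-- The type at angle `ψ` of the unit circle. -/
noncomputable def circlePoint (ψ : ℝ) : TypeSpace 2 :=
  ⟨!₂[Real.cos ψ, Real.sin ψ], by
    rw [mem_sphere_zero_iff_norm, EuclideanSpace.norm_eq, Real.sqrt_eq_one]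
    simp [Fin.sum_univ_two]⟩

/-- The angle in `(-π, π]` of a type on the unit circle. -/
noncomputable def angle (θ : TypeSpace 2) : ℝ :=
  Complex.arg ⟨θ.1 0, θ.1 1⟩

theorem inner_circlePoint (v : EuclideanSpace ℝ (Fin 2)) (ψ : ℝ) :
    inner ℝ v (circlePoint ψ : EuclideanSpace ℝ (Fin 2)) =
      v 0 * Real.cos ψ + v 1 * Real.sin ψ := by
  simp [circlePoint, PiLp.inner_apply, Fin.sum_univ_two, mul_comm]

theorem measurable_angle : Measurable angle := by
  have h0 : Measurable fun θ : TypeSpace 2 => θ.1 0 := by fun_prop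
  have h1 : Measurable fun θ : TypeSpace 2 => θ.1 1 := by fun_prop
  have h : Measurable fun θ : TypeSpace 2 => ((θ.1 0 : ℝ) : ℂ) + ((θ.1 1 : ℝ) : ℂ) * Complex.I :=
    (Complex.measurable_ofReal.comp h0).add
      ((Complex.measurable_ofReal.comp h1).mul_const _)
  have h2 := Complex.measurable_arg.comp h
  have heq : angle = Complex.arg ∘
      fun θ : TypeSpace 2 => ((θ.1 0 : ℝ) : ℂ) + ((θ.1 1 : ℝ) : ℂ) * Complex.I := by
    ext θ
    simp only [angle, Function.comp_apply, Complex.mk_eq_add_mul_I]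
  rw [heq]
  exact h2

theorem circlePoint_angle (θ : TypeSpace 2) : circlePoint (angle θ) = θ := by
  have hn : ‖(⟨θ.1 0, θ.1 1⟩ : ℂ)‖ = 1 := by
    have h := mem_sphere_zero_iff_norm.1 θ.2
    rw [EuclideanSpace.norm_eq, Real.sqrt_eq_one, Fin.sum_univ_two] at h
    rw [Complex.norm_def, Real.sqrt_eq_one, Complex.normSq_mk]
    simpa [sq] using h
  have h0 : (⟨θ.1 0, θ.1 1⟩ : ℂ) ≠ 0 := norm_pos_iff.1 (by rw [hn]; exact one_pos)
  refine Subtype.ext ?_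
  ext i
  fin_cases i
  · simp [circlePoint, angle, Complex.cos_arg h0, hn]
  · simp [circlePoint, angle, Complex.sin_arg, hn]

theorem angle_circlePoint {ψ : ℝ} (h : ψ ∈ Set.Ioc (-Real.pi) Real.pi) :
    angle (circlePoint ψ) = ψ := by
  have h1 : (⟨(circlePoint ψ).1 0, (circlePoint ψ).1 1⟩ : ℂ) =
      Complex.cos ψ + Complex.sin ψ * Complex.I := by
    apply Complex.ext <;> simp [circlePoint, Complex.cos_ofReal_re, Complex.sin_ofReal_re]
  rw [angle, h1, Complex.arg_cos_add_sin_mul_I h]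

theorem circlePoint_add_two_pi (ψ : ℝ) : circlePoint (ψ + 2 * Real.pi) = circlePoint ψ := by
  refine Subtype.ext ?_
  simp [circlePoint]

theorem circlePoint_neg_pi : circlePoint (-Real.pi) = circlePoint Real.pi := by
  rw [← circlePoint_add_two_pi (-Real.pi)]
  congr 1
  ring

theorem sin_smul_circlePoint (α b β : ℝ) :
    Real.sin (β - α) • (circlePoint b : EuclideanSpace ℝ (Fin 2)) =
      Real.sin (β - b) • (circlePoint α : EuclideanSpace ℝ (Fin 2)) +
        Real.sin (b - α) • (circlePoint β : EuclideanSpace ℝ (Fin 2)) := by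
  have h1 := Real.sin_sq_add_cos_sq b
  ext i
  fin_cases i
  · simp only [circlePoint, Real.sin_sub]
    simp
    ring
  · simp only [circlePoint, Real.sin_sub]
    simp
    ring

/-- A vector whose product with the unit vectors on an arc is maximal in the interior of the arc,
with value zero, vanishes. -/
theorem eq_zero_of_inner_circlePoint_nonpos {v : EuclideanSpace ℝ (Fin 2)} {a b m : ℝ}
    (ha : a < m) (hb : m < b)
    (hle : ∀ ψ ∈ Set.Icc a b, inner ℝ v (circlePoint ψ : EuclideanSpace ℝ (Fin 2)) ≤ 0)
    (hm : inner ℝ v (circlePoint m : EuclideanSpace ℝ (Fin 2)) = 0) : v = 0 := by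
  simp only [inner_circlePoint] at hle hm
  -- The value and the derivative at `m` are the coordinates of `v` in an orthonormal frame, and
  -- both vanish.
  have hmax : IsLocalMax (fun ψ => v 0 * Real.cos ψ + v 1 * Real.sin ψ) m := by
    filter_upwards [Icc_mem_nhds ha hb] with ψ hψ
    rw [hm]
    exact hle ψ hψ
  have hd : HasDerivAt (fun ψ => v 0 * Real.cos ψ + v 1 * Real.sin ψ)
      (v 0 * -Real.sin m + v 1 * Real.cos m) m :=
    ((Real.hasDerivAt_cos m).const_mul _).add ((Real.hasDerivAt_sin m).const_mul _)
  have h0 := hmax.hasDerivAt_eq_zero hd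
  have hs := Real.sin_sq_add_cos_sq m
  ext i
  fin_cases i
  · change v 0 = 0
    linear_combination (-v 0) * hs + Real.cos m * hm - Real.sin m * h0
  · change v 1 = 0
    linear_combination (-v 1) * hs + Real.sin m * hm + Real.cos m * h0

end Circle

/-! ### Three alternatives: rescaling arcs -/

namespace Mechanism

variable {x : Mechanism 2} {y : TypeSpace 2 → EuclideanSpace ℝ (Fin 2)} {C : ℝ}

/-- Domination between any two types on an arc that are at most half a turn apart. -/
def DominatesOn (x : Mechanism 2) (y : TypeSpace 2 → EuclideanSpace ℝ (Fin 2)) (C a b : ℝ) : Prop :=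
  ∀ α β, a ≤ α → α ≤ β → β ≤ b → β - α ≤ Real.pi →
    x.Dominates y C (circlePoint α) (circlePoint β) ∧
      x.Dominates y C (circlePoint β) (circlePoint α)

/-- On an arc of at most half a turn, the sine identity places `b` in the cone of the endpoints with
nonnegative weights. -/
theorem dominates_circlePoint_trans {α b β : ℝ} (hαb : α ≤ b) (hbβ : b ≤ β)
    (hαβ : β - α ≤ Real.pi)
    (h1 : x.Dominates y C (circlePoint α) (circlePoint b) ∧
      x.Dominates y C (circlePoint b) (circlePoint α))
    (h2 : x.Dominates y C (circlePoint b) (circlePoint β) ∧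
      x.Dominates y C (circlePoint β) (circlePoint b)) :
    x.Dominates y C (circlePoint α) (circlePoint β) ∧
      x.Dominates y C (circlePoint β) (circlePoint α) := by
  rcases hαb.eq_or_lt with rfl | hαb
  · exact h2
  rcases hbβ.eq_or_lt with rfl | hbβ
  · exact h1
  have hP : 0 < Real.sin (β - b) := Real.sin_pos_of_pos_of_lt_pi (by linarith) (by linarith)
  have hQ : 0 < Real.sin (b - α) := Real.sin_pos_of_pos_of_lt_pi (by linarith) (by linarith)
  have hS : 0 ≤ Real.sin (β - α) := Real.sin_nonneg_of_nonneg_of_le_pi (by linarith) hαβ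
  have h := sin_smul_circlePoint α b β
  exact ⟨Dominates.trans hP hQ.le hS h h1.1 h2.1 h2.2,
    Dominates.trans hQ hP.le hS (h.trans (add_comm _ _)) h2.2 h1.2 h1.1⟩

theorem DominatesOn.append {a b c : ℝ} (h1 : x.DominatesOn y C a b)
    (h2 : x.DominatesOn y C b c) : x.DominatesOn y C a c := by
  intro α β ha hαβ hc hπ
  rcases le_total β b with hβ | hβ
  · exact h1 α β ha hαβ hβ hπ
  rcases le_total b α with hα | hα
  · exact h2 α β hα hαβ hc hπ
  exact dominates_circlePoint_trans hα hβ hπ (h1 α b ha hα le_rfl (by linarith))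
    (h2 b β le_rfl hβ hc (by linarith))

theorem dominatesOn_of_affine {a b c : ℝ} {t : EuclideanSpace ℝ (Fin 2)} (hc : |c| ≤ C)
    (h : ∀ ψ, a ≤ ψ → ψ ≤ b → y (circlePoint ψ) = c • x.alloc (circlePoint ψ) + t) :
    x.DominatesOn y C a b := by
  have key : ∀ α β, a ≤ α → α ≤ b → a ≤ β → β ≤ b →
      x.Dominates y C (circlePoint α) (circlePoint β) := by
    intro α β h1 h2 h3 h4
    unfold Dominates
    rw [h α h1 h2, h β h3 h4, add_sub_add_right_eq_sub, ← smul_sub, inner_smul_left,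
      RCLike.conj_to_real, abs_mul]
    have h0 : 0 ≤ inner ℝ (x.alloc (circlePoint α) - x.alloc (circlePoint β))
        (circlePoint α : EuclideanSpace ℝ (Fin 2)) := by
      rw [inner_sub_left]
      exact sub_nonneg.2 (x.incentive_compatible _ _)
    rw [abs_of_nonneg h0]
    exact mul_le_mul_of_nonneg_right hc h0
  intro α β h1 h2 h3 _
  exact ⟨key α β h1 (h2.trans h3) (h1.trans h2) h3, key β α (h1.trans h2) h3 h1 (h2.trans h3)⟩

/-- Types more than half a turn apart in angle are compared the other way round, through `π = -π`.
-/
theorem dominates_of_dominatesOn (h : x.DominatesOn y C (-Real.pi) Real.pi) (θ θ' : TypeSpace 2) :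
    x.Dominates y C θ θ' := by
  have key : ∀ α β, α ∈ Set.Ioc (-Real.pi) Real.pi → β ∈ Set.Ioc (-Real.pi) Real.pi → α ≤ β →
      x.Dominates y C (circlePoint α) (circlePoint β) ∧
        x.Dominates y C (circlePoint β) (circlePoint α) := by
    intro α β hα hβ hαβ
    rcases le_total (β - α) Real.pi with hπ | hπ
    · exact h α β hα.1.le hαβ hβ.2 hπ
    have h1 := h β Real.pi hβ.1.le hβ.2 le_rfl (by linarith [hα.1])
    have h2 := h (-Real.pi) α le_rfl hα.1.le hα.2 (by linarith [hβ.2])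
    rw [circlePoint_neg_pi, ← circlePoint_add_two_pi α] at h2
    have h3 := dominates_circlePoint_trans hβ.2 (by linarith [hα.1]) (by linarith) h1 h2
    rw [circlePoint_add_two_pi] at h3
    exact ⟨h3.2, h3.1⟩
  have hmem : ∀ θ, angle θ ∈ Set.Ioc (-Real.pi) Real.pi := fun θ => Complex.arg_mem_Ioc _
  rw [← circlePoint_angle θ, ← circlePoint_angle θ']
  rcases le_total (angle θ) (angle θ') with hle | hle
  · exact (key _ _ (hmem _) (hmem _) hle).1
  · exact (key _ _ (hmem _) (hmem _) hle).2

/-- The arc, among the four arcs cut out by the angles `φ 0 < φ 1 < φ 2 < φ 3`, of an angle in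
`(-π, π]`. -/
noncomputable def arc (φ : Fin 4 → ℝ) (ψ : ℝ) : Fin 4 :=
  if ψ < φ 0 then 3 else if ψ < φ 1 then 0 else if ψ < φ 2 then 1 else if ψ < φ 3 then 2 else 3

theorem measurable_arc (φ : Fin 4 → ℝ) : Measurable (arc φ) := by
  unfold arc
  refine Measurable.ite measurableSet_Iio measurable_const ?_
  refine Measurable.ite measurableSet_Iio measurable_const ?_
  refine Measurable.ite measurableSet_Iio measurable_const ?_
  exact Measurable.ite measurableSet_Iio measurable_const measurable_const

/-- Rescaling the four boundary arcs of a planar body separately. -/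
noncomputable def rescale (x : Mechanism 2) (φ : Fin 4 → ℝ) (c : Fin 4 → ℝ)
    (t : Fin 4 → EuclideanSpace ℝ (Fin 2)) (θ : TypeSpace 2) : EuclideanSpace ℝ (Fin 2) :=
  c (arc φ (angle θ)) • x.alloc θ + t (arc φ (angle θ))

theorem measurable_rescale (x : Mechanism 2) (φ : Fin 4 → ℝ) (c : Fin 4 → ℝ)
    (t : Fin 4 → EuclideanSpace ℝ (Fin 2)) : Measurable (x.rescale φ c t) := by
  have ha : Measurable fun θ => arc φ (angle θ) := (measurable_arc φ).comp measurable_angle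
  have hc : Measurable fun θ => c (arc φ (angle θ)) := (measurable_of_finite c).comp ha
  have ht : Measurable fun θ => t (arc φ (angle θ)) := (measurable_of_finite t).comp ha
  exact (hc.smul x.measurable_alloc).add ht

/-- There is a nontrivial rescaling of the arcs that closes up and keeps three payoffs. -/
theorem exists_rescaling (p : Fin 4 → EuclideanSpace ℝ (Fin 2)) (a : Fin 3 → Fin 4)
    (w n : Fin 3 → EuclideanSpace ℝ (Fin 2)) :
    ∃ (c : Fin 4 → ℝ) (t : Fin 4 → EuclideanSpace ℝ (Fin 2)), ¬ (c = 0 ∧ t = 0) ∧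
      (∀ j, c (j - 1) • p j + t (j - 1) = c j • p j + t j) ∧
      ∀ k, inner ℝ (c (a k) • w k + t (a k)) (n k) = 0 := by
  let F : ((Fin 4 → ℝ) × (Fin 4 → EuclideanSpace ℝ (Fin 2))) →ₗ[ℝ]
      ((Fin 4 → EuclideanSpace ℝ (Fin 2)) × (Fin 3 → ℝ)) :=
    { toFun := fun ct => (fun j => (ct.1 (j - 1) • p j + ct.2 (j - 1)) - (ct.1 j • p j + ct.2 j),
        fun k => inner ℝ (ct.1 (a k) • w k + ct.2 (a k)) (n k))
      map_add' := fun u v => by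
        refine Prod.ext (funext fun j => ?_) (funext fun k => ?_)
        · simp only [Prod.fst_add, Prod.snd_add, Pi.add_apply]
          module
        · simp only [Prod.fst_add, Prod.snd_add, Pi.add_apply, ← inner_add_left]
          congr 1
          module
      map_smul' := fun r u => by
        refine Prod.ext (funext fun j => ?_) (funext fun k => ?_)
        · simp only [Prod.smul_fst, Prod.smul_snd, Pi.smul_apply, RingHom.id_apply, smul_eq_mul]
          module
        · simp only [Prod.smul_fst, Prod.smul_snd, Pi.smul_apply, RingHom.id_apply, smul_eq_mul,
            inner_add_left, inner_smul_left, RCLike.conj_to_real]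
          ring }
  -- There are 4 + 8 = 12 unknowns and 8 + 3 = 11 equations.
  have hker : LinearMap.ker F ≠ ⊥ := by
    refine LinearMap.ker_ne_bot_of_finrank_lt ?_
    simp [Module.finrank_prod, Module.finrank_pi_fintype]
  obtain ⟨⟨c, t⟩, hmem, hne⟩ := Submodule.exists_mem_ne_zero_of_ne_bot hker
  rw [LinearMap.mem_ker] at hmem
  refine ⟨c, t, fun h => hne (Prod.ext h.1 h.2), fun j => ?_, fun k => ?_⟩
  · exact sub_eq_zero.1 (congrFun (congrArg Prod.fst hmem) j)
  · exact congrFun (congrArg Prod.snd hmem) k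

section Arcs

variable {φ : Fin 4 → ℝ} {c : Fin 4 → ℝ} {t : Fin 4 → EuclideanSpace ℝ (Fin 2)}

/-- The matching conditions make the formulas of adjacent arcs agree at the cuts, so each holds on
its closed arc. The last arc wraps around through `±π` and appears twice. -/
theorem rescale_circlePoint (hφ : StrictMono φ) (hlo : -Real.pi < φ 0) (hhi : φ 3 ≤ Real.pi)
    (hmatch : ∀ j, c (j - 1) • x.alloc (circlePoint (φ j)) + t (j - 1) =
      c j • x.alloc (circlePoint (φ j)) + t j) :
    (∀ ψ, -Real.pi ≤ ψ → ψ ≤ φ 0 →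
      x.rescale φ c t (circlePoint ψ) = c 3 • x.alloc (circlePoint ψ) + t 3) ∧
    (∀ ψ, φ 0 ≤ ψ → ψ ≤ φ 1 →
      x.rescale φ c t (circlePoint ψ) = c 0 • x.alloc (circlePoint ψ) + t 0) ∧
    (∀ ψ, φ 1 ≤ ψ → ψ ≤ φ 2 →
      x.rescale φ c t (circlePoint ψ) = c 1 • x.alloc (circlePoint ψ) + t 1) ∧
    (∀ ψ, φ 2 ≤ ψ → ψ ≤ φ 3 →
      x.rescale φ c t (circlePoint ψ) = c 2 • x.alloc (circlePoint ψ) + t 2) ∧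
    (∀ ψ, φ 3 ≤ ψ → ψ ≤ Real.pi →
      x.rescale φ c t (circlePoint ψ) = c 3 • x.alloc (circlePoint ψ) + t 3) := by
  have h01 : φ 0 < φ 1 := hφ (by decide)
  have h12 : φ 1 < φ 2 := hφ (by decide)
  have h23 : φ 2 < φ 3 := hφ (by decide)
  have hr : ∀ ψ, -Real.pi < ψ → ψ ≤ Real.pi → x.rescale φ c t (circlePoint ψ) =
      c (arc φ ψ) • x.alloc (circlePoint ψ) + t (arc φ ψ) := by
    intro ψ h1 h2
    rw [rescale, angle_circlePoint ⟨h1, h2⟩]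
  have hcut : ∀ j, x.rescale φ c t (circlePoint (φ j)) =
      c j • x.alloc (circlePoint (φ j)) + t j := by
    intro j
    have hj : arc φ (φ j) = j := by
      fin_cases j <;> simp [arc, h01, h12, h23, h01.le, h12.le, h23.le, (h01.trans h12).le,
        (h12.trans h23).le, (h01.trans (h12.trans h23)).le, not_lt_of_ge]
    have h1 : φ 0 ≤ φ j := hφ.monotone (Fin.zero_le _)
    have h2 : φ j ≤ φ 3 := hφ.monotone (Fin.le_last _)
    rw [hr _ (by linarith) (by linarith), hj]
  have h3 : ∀ ψ, φ 3 ≤ ψ → ψ ≤ Real.pi →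
      x.rescale φ c t (circlePoint ψ) = c 3 • x.alloc (circlePoint ψ) + t 3 := by
    intro ψ h1 h2
    have : arc φ ψ = 3 := by
      rw [arc, if_neg (by linarith), if_neg (by linarith), if_neg (by linarith),
        if_neg (by linarith)]
    rw [hr ψ (by linarith) h2, this]
  refine ⟨fun ψ h1 h2 => ?_, fun ψ h1 h2 => ?_, fun ψ h1 h2 => ?_, fun ψ h1 h2 => ?_, h3⟩
  · rcases h2.eq_or_lt with rfl | h2
    · rw [hcut, ← hmatch 0]
      rfl
    rcases h1.eq_or_lt with rfl | h1
    · rw [circlePoint_neg_pi]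
      exact h3 _ hhi le_rfl
    have : arc φ ψ = 3 := by rw [arc, if_pos h2]
    rw [hr ψ h1 (by linarith), this]
  · rcases h2.eq_or_lt with rfl | h2
    · rw [hcut, ← hmatch 1]
      rfl
    have : arc φ ψ = 0 := by rw [arc, if_neg (by linarith), if_pos h2]
    rw [hr ψ (by linarith) (by linarith), this]
  · rcases h2.eq_or_lt with rfl | h2
    · rw [hcut, ← hmatch 2]
      rfl
    have : arc φ ψ = 1 := by rw [arc, if_neg (by linarith), if_neg (by linarith), if_pos h2]
    rw [hr ψ (by linarith) (by linarith), this]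
  · rcases h2.eq_or_lt with rfl | h2
    · rw [hcut, ← hmatch 3]
      rfl
    have : arc φ ψ = 2 := by
      rw [arc, if_neg (by linarith), if_neg (by linarith), if_neg (by linarith), if_pos h2]
    rw [hr ψ (by linarith) (by linarith), this]

/-- The payoffs of a body are not linear between two different exposed points. -/
theorem eq_zero_of_inner_eq_zero_on_arc {a b c : ℝ} {t : EuclideanSpace ℝ (Fin 2)} (hab : a < b)
    (ha : x.UniqueAt (circlePoint a)) (hb : x.UniqueAt (circlePoint b))
    (hne : x.alloc (circlePoint a) ≠ x.alloc (circlePoint b))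
    (h : ∀ ψ, a ≤ ψ → ψ ≤ b → inner ℝ (c • x.alloc (circlePoint ψ) + t)
      (circlePoint ψ : EuclideanSpace ℝ (Fin 2)) = 0) : c = 0 ∧ t = 0 := by
  have ham : a < (a + b) / 2 := by linarith
  have hmb : (a + b) / 2 < b := by linarith
  have hc : c = 0 := by
    by_contra hc
    -- If `c ≠ 0`, `supp` is linear along the arc. The allocation at the middle type is then the
    -- representing vector, hence optimal at both ends, and uniqueness there contradicts `hne`.
    have hlin : ∀ ψ, a ≤ ψ → ψ ≤ b → x.supp (circlePoint ψ) =
        inner ℝ (-(c⁻¹ • t)) (circlePoint ψ : EuclideanSpace ℝ (Fin 2)) := by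
      intro ψ h1 h2
      have h3 := h ψ h1 h2
      rw [inner_add_left, inner_smul_left, RCLike.conj_to_real] at h3
      rw [supp_coe, inner_neg_left, inner_smul_left, RCLike.conj_to_real]
      field_simp
      linarith
    have hm : x.alloc (circlePoint ((a + b) / 2)) = -(c⁻¹ • t) := by
      rw [← sub_eq_zero]
      refine eq_zero_of_inner_circlePoint_nonpos ham hmb (fun ψ hψ => ?_) ?_
      · rw [inner_sub_left, ← hlin ψ hψ.1 hψ.2]
        exact sub_nonpos.2 (x.inner_le_supp _ _)
      · rw [inner_sub_left, ← hlin _ ham.le hmb.le, supp_coe, sub_self]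
    have h1 := ha (x.alloc (circlePoint ((a + b) / 2))) (x.inner_le_supp _)
      (by rw [hlin a le_rfl hab.le, hm])
    have h2 := hb (x.alloc (circlePoint ((a + b) / 2))) (x.inner_le_supp _)
      (by rw [hlin b hab.le le_rfl, hm])
    exact hne (h1.symm.trans h2)
  have h' : ∀ ψ, a ≤ ψ → ψ ≤ b → inner ℝ t (circlePoint ψ : EuclideanSpace ℝ (Fin 2)) = 0 := by
    intro ψ h1 h2
    have := h ψ h1 h2
    rwa [hc, zero_smul, zero_add] at this
  exact ⟨hc, eq_zero_of_inner_circlePoint_nonpos ham hmb (fun ψ hψ => (h' ψ hψ.1 hψ.2).le)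
    (h' _ ham.le hmb.le)⟩

end Arcs

/-- With three alternatives, the menu of an extreme point has at most three elements. -/
theorem encard_menu_le_of_mem_extremePoints {x : Mechanism 2}
    (hx : x.toL1 ∈ (mechanismClasses 2).extremePoints ℝ) : x.menu.encard ≤ 3 := by
  by_contra hcard
  obtain ⟨s, hs, hsu, hinj⟩ := exists_finset_uniqueAt (n := 3) hcard
  have hang : Function.Injective angle := fun θ θ' h => by
    rw [← circlePoint_angle θ, h, circlePoint_angle]
  have hcardA : (s.map ⟨angle, hang⟩).card = 4 := by rw [Finset.card_map, hs]
  -- Angles, in increasing order, of four types with different unique optima.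
  let φ : Fin 4 → ℝ := fun j => (s.map ⟨angle, hang⟩).orderEmbOfFin hcardA j
  have hφ : StrictMono φ := ((s.map ⟨angle, hang⟩).orderEmbOfFin hcardA).strictMono
  have hφmem : ∀ j, ∃ θ ∈ s, angle θ = φ j := fun j => by
    have := Finset.orderEmbOfFin_mem (s.map ⟨angle, hang⟩) hcardA j
    obtain ⟨θ, hθ, h⟩ := Finset.mem_map.1 this
    exact ⟨θ, hθ, h⟩
  have hφs : ∀ j, circlePoint (φ j) ∈ s := fun j => by
    obtain ⟨θ, hθ, h⟩ := hφmem j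
    rwa [← h, circlePoint_angle]
  have hφI : ∀ j, φ j ∈ Set.Ioc (-Real.pi) Real.pi := fun j => by
    obtain ⟨θ, hθ, h⟩ := hφmem j
    rw [← h]
    exact Complex.arg_mem_Ioc _
  have hne : ∀ i j, i ≠ j → x.alloc (circlePoint (φ i)) ≠ x.alloc (circlePoint (φ j)) := by
    intro i j hij h
    have h1 := congrArg angle (hinj (hφs i) (hφs j) h)
    rw [angle_circlePoint (hφI i), angle_circlePoint (hφI j)] at h1
    exact hij (hφ.injective h1)
  let ν : Fin 3 → TypeSpace 2 := fun k => dir (facetNormal_ne_zero k)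
  obtain ⟨c, t, hct, hmatch, hν⟩ := exists_rescaling (fun j => x.alloc (circlePoint (φ j)))
    (fun k => arc φ (angle (ν k))) (fun k => x.alloc (ν k)) (fun k => facetNormal k)
  obtain ⟨hA, hB0, hB1, hB2, hB3⟩ := rescale_circlePoint hφ (hφI 0).1 (hφI 3).2 hmatch
  have hC : ∀ j, |c j| ≤ ∑ j, |c j| := fun j =>
    Finset.single_le_sum (f := fun j => |c j|) (fun i _ => abs_nonneg _) (Finset.mem_univ j)
  set C := ∑ j, |c j| with hCdef
  have hC0 : 0 ≤ C := Finset.sum_nonneg fun j _ => abs_nonneg _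
  have hdom := dominates_of_dominatesOn ((((((dominatesOn_of_affine (hC 3) hA).append
    (dominatesOn_of_affine (hC 0) hB0)).append (dominatesOn_of_affine (hC 1) hB1)).append
    (dominatesOn_of_affine (hC 2) hB2)).append (dominatesOn_of_affine (hC 3) hB3)))
  -- Dividing by `C + 1` brings the domination constant below one, so adding or subtracting the
  -- perturbation keeps incentive compatibility.
  have hε : 0 < (C + 1)⁻¹ := by positivity
  have hic : ∀ θ θ' : TypeSpace 2,
      |inner ℝ ((C + 1)⁻¹ • x.rescale φ c t θ - (C + 1)⁻¹ • x.rescale φ c t θ')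
        (θ : EuclideanSpace ℝ (Fin 2))| ≤
      inner ℝ (x.alloc θ - x.alloc θ') (θ : EuclideanSpace ℝ (Fin 2)) := by
    intro θ θ'
    have h1 := hdom θ θ'
    unfold Dominates at h1
    rw [← smul_sub, inner_smul_left, RCLike.conj_to_real, abs_mul, abs_of_pos hε,
      inv_mul_le_iff₀ (by positivity)]
    have h0 : 0 ≤ inner ℝ (x.alloc θ - x.alloc θ') (θ : EuclideanSpace ℝ (Fin 2)) := by
      rw [inner_sub_left]
      exact sub_nonneg.2 (x.incentive_compatible _ _)
    linarith
  -- The perturbation has payoff zero for each facet-normal type. Domination from that type then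
  -- bounds the change at `θ` by the distance of `x` at `θ` from its own maximum in the facet
  -- direction.
  have hmem : ∀ σ : ℝ, |σ| = 1 → ∀ θ,
      x.alloc θ + σ • (C + 1)⁻¹ • x.rescale φ c t θ ∈ lotteries 2 := by
    intro σ hσ θ
    rw [mem_lotteries_iff]
    intro k
    have hk : inner ℝ (x.rescale φ c t (ν k)) (facetNormal k) = 0 := hν k
    have h1 := hic (ν k) θ
    have h2 := mem_lotteries_iff.1 (x.alloc_mem (ν k)) k
    have hnn := norm_smul_dir (facetNormal_ne_zero k)
    have h3 : |inner ℝ ((C + 1)⁻¹ • x.rescale φ c t (ν k) - (C + 1)⁻¹ • x.rescale φ c t θ)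
        (facetNormal k)| ≤ inner ℝ (x.alloc (ν k) - x.alloc θ) (facetNormal k) := by
      have h4 := mul_le_mul_of_nonneg_left h1 (norm_nonneg (facetNormal k))
      rw [← abs_of_nonneg (norm_nonneg (facetNormal k)), ← abs_mul,
        abs_of_nonneg (norm_nonneg (facetNormal k)), ← inner_smul_right, ← inner_smul_right] at h4
      rwa [hnn] at h4
    rw [inner_sub_left, inner_sub_left, inner_smul_left, hk, mul_zero, zero_sub, abs_neg] at h3
    rw [prob_eq] at h2 ⊢
    rw [inner_add_left, inner_smul_left, RCLike.conj_to_real]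
    have h5 : |σ * inner ℝ ((C + 1)⁻¹ • x.rescale φ c t θ) (facetNormal k)| ≤
        inner ℝ (x.alloc (ν k)) (facetNormal k) - inner ℝ (x.alloc θ) (facetNormal k) := by
      rw [abs_mul, hσ, one_mul]
      exact h3
    linarith [(abs_le.1 h5).2]
  have hzero := inner_eq_zero_of_mem_extremePoints hx
    (y := fun θ => (C + 1)⁻¹ • x.rescale φ c t θ) ((measurable_rescale x φ c t).const_smul (C + 1)⁻¹)
    (fun θ => by simpa using hmem 1 (by simp) θ)
    (fun θ => by simpa [sub_eq_add_neg] using hmem (-1) (by simp) θ) hic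
  have hzero' : ∀ θ, inner ℝ (x.rescale φ c t θ) (θ : EuclideanSpace ℝ (Fin 2)) = 0 := by
    intro θ
    have := hzero θ
    rw [inner_smul_left, RCLike.conj_to_real] at this
    exact (mul_eq_zero.1 this).resolve_left hε.ne'
  have hu : ∀ j, x.UniqueAt (circlePoint (φ j)) := fun j => hsu _ (hφs j)
  obtain ⟨hc0, ht0⟩ := eq_zero_of_inner_eq_zero_on_arc (hφ (by decide : (0 : Fin 4) < 1)) (hu 0)
    (hu 1) (hne 0 1 (by decide)) fun ψ h1 h2 => by rw [← hB0 ψ h1 h2]; exact hzero' _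
  obtain ⟨hc1, ht1⟩ := eq_zero_of_inner_eq_zero_on_arc (hφ (by decide : (1 : Fin 4) < 2)) (hu 1)
    (hu 2) (hne 1 2 (by decide)) fun ψ h1 h2 => by rw [← hB1 ψ h1 h2]; exact hzero' _
  obtain ⟨hc2, ht2⟩ := eq_zero_of_inner_eq_zero_on_arc (hφ (by decide : (2 : Fin 4) < 3)) (hu 2)
    (hu 3) (hne 2 3 (by decide)) fun ψ h1 h2 => by rw [← hB2 ψ h1 h2]; exact hzero' _
  -- The wrapping arc needs no payoff argument: matching at its two ends, whose allocations differ,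
  -- gives `c 3 = 0` and `t 3 = 0`.
  have hm0 : c 3 • x.alloc (circlePoint (φ 0)) + t 3 = 0 := by
    have : c 3 • x.alloc (circlePoint (φ 0)) + t 3 = c 0 • x.alloc (circlePoint (φ 0)) + t 0 :=
      hmatch 0
    rw [this, hc0, ht0, zero_smul, zero_add]
  have hm3 : c 3 • x.alloc (circlePoint (φ 3)) + t 3 = 0 := by
    have : c 2 • x.alloc (circlePoint (φ 3)) + t 2 = c 3 • x.alloc (circlePoint (φ 3)) + t 3 :=
      hmatch 3
    rw [← this, hc2, ht2, zero_smul, zero_add]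
  have hc3 : c 3 = 0 := by
    have h1 : c 3 • (x.alloc (circlePoint (φ 0)) - x.alloc (circlePoint (φ 3))) = 0 := by
      rw [smul_sub, sub_eq_zero]
      exact add_right_cancel (hm0.trans hm3.symm)
    exact (smul_eq_zero.1 h1).resolve_right (sub_ne_zero.2 (hne 0 3 (by decide)))
  have ht3 : t 3 = 0 := by rwa [hc3, zero_smul, zero_add] at hm0
  refine hct ⟨?_, ?_⟩
  · ext j
    fin_cases j
    exacts [hc0, hc1, hc2, hc3]
  · funext j
    fin_cases j
    exacts [ht0, ht1, ht2, ht3]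

/-- A mechanism that dictates an alternative is an extreme point. -/
theorem DictatesAlternative.toL1_mem_extremePoints {d : ℕ} [NeZero d] {x : Mechanism d}
    (h : x.DictatesAlternative) : x.toL1 ∈ (mechanismClasses d).extremePoints ℝ := by
  obtain ⟨a, ha, hmenu⟩ := h
  rw [menu_eq_singleton_iff] at hmenu
  refine ⟨⟨x, rfl⟩, ?_⟩
  rintro _ ⟨y, rfl⟩ _ ⟨w, rfl⟩ ⟨s, t, hs, ht, hst, h⟩
  have hx := supp_combination h
  rw [toL1_eq_iff]
  -- The mixture lies in the body of `x`, which is the point `a`. Extremality of `a` in the simplex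
  -- then fixes `y`.
  have hconst : ∀ θ, s • y.alloc θ + t • w.alloc θ = a := by
    intro θ
    have h1 : inner ℝ (s • y.alloc θ + t • w.alloc θ) (s • y.alloc θ + t • w.alloc θ - a) ≤
        inner ℝ a (s • y.alloc θ + t • w.alloc θ - a) := by
      rw [← hmenu, hx, inner_add_left, inner_smul_left, inner_smul_left]
      exact add_le_add (mul_le_mul_of_nonneg_left (y.inner_le_supp _ _) hs.le)
        (mul_le_mul_of_nonneg_left (w.inner_le_supp _ _) ht.le)
    rw [← sub_nonpos, ← inner_sub_left] at h1
    exact sub_eq_zero.1 (real_inner_self_nonpos.1 h1)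
  refine supp_eq_of_ae x.supp_lipschitz.continuous (fun c hc z => x.supp_smul hc z)
    (Filter.Eventually.of_forall fun θ => ?_)
  rw [supp_coe, hmenu,
    ha.2 (y.alloc_mem θ) (w.alloc_mem θ) ⟨s, t, hs, ht, hst, hconst θ⟩]

end Mechanism

end LinearDelegation

theorem mainTheorem8 :
    -- three alternatives (`d + 1 = 3`)
    (∀ x : LinearDelegation.Mechanism 2,
      x.toL1 ∈ (LinearDelegation.mechanismClasses 2).extremePoints ℝ ↔
        x.DictatesAlternative ∨ (x.GrantsStrike ∧ x.menu.encard ≤ 3)) ∧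
    -- at least four alternatives (`d + 1 ≥ 4`): density in the `L¹` norm
    (∀ d : ℕ, 4 ≤ d + 1 →
      LinearDelegation.strikeClasses d ⊆
        closure ((LinearDelegation.mechanismClasses d).extremePoints ℝ ∩
          LinearDelegation.strikeClasses d)) := by
  refine ⟨fun x => ⟨fun hx => ?_, ?_⟩,
    fun d hd => LinearDelegation.strikeClasses_subset_closure (by omega)⟩
  · by_cases hstrike : x.GrantsStrike
    · exact Or.inr ⟨hstrike,
        LinearDelegation.Mechanism.encard_menu_le_of_mem_extremePoints hx⟩
    · rw [LinearDelegation.Mechanism.grantsStrike_iff] at hstrike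
      push Not at hstrike
      obtain ⟨k, hk⟩ := hstrike
      exact Or.inl ⟨_, LinearDelegation.vertex_mem_extremePoints k,
        LinearDelegation.Mechanism.menu_eq_singleton_iff.2
          (LinearDelegation.Mechanism.supp_eq_of_mem_extremePoints hx hk)⟩
  · rintro (h | ⟨h1, h2⟩)
    · exact h.toL1_mem_extremePoints
    · exact LinearDelegation.Mechanism.toL1_mem_extremePoints_of_encard_le h1 h2
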